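/- **Setting.** Let $X$ be a double torus, i.e. a closed connected oriented surface of Euler characteristic $-2$, with a finite cell decomposition (loops and multiple edges allowed in the 1-skeleton, which is given by its rotation system). Let $G$ be a finite graph embedded in $X$ as a subgraph of the 1-skeleton (not necessarily spanning it), and let $C$ be a simple closed oriented curve along the 1-skeleton which contains no edge of $G$ (so that it meets $G$ in vertices only), such that $X\setminus C$ has exactly two components, one on the left and one on the right of $C$, and the closure of each component is a torus with an open disc bounded by $C$ removed. Let $v^1,\dots,v^k$ be the vertices of $G$ on $C$ in the order along $C$ from a chosen starting point, and let $G_1$, $G_2$ be the parts of $G$ in the closures $T_1$ (left) and $T_2$ (right) of the two components. (The parity of $k$ and of the numbers of vertices of $G$ in the components is not restricted.) **Targets.** The target $S$ is the star with $k$ legs of length two; its $i$-th leg has the inner edge $\{v_3,v_2^i\}$ and the outer edge $\{v_2^i,v_1^i\}$, where $v_3$ is the common centre. $G_j^S$ arises from the disjoint union of $G_j$ and $S$ by identifying $v_1^i$ with $v^i$ for $i=1,\dots,k$. It is embedded in the closed torus $X_j$ obtained from $T_j$ by gluing a disc along $C$, with $S$ drawn in this disc. **Generating functions.** A set $E'$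 of edges of a graph is *even* if every vertex has even degree in the graph with edge set $E'$ (loops count twice). A quadratic form on $H_1(Y;\mathbb F_2)$, for a closed surface $Y$, is a map $q:H_1(Y;\mathbb F_2)\to\mathbb F_2$ with $q(a+b)=q(a)+q(b)+a\cdot b$, where $\cdot$ is the mod 2 intersection form. For a graph $\Gamma$ embedded in $Y$ with edge variables $y=(y_e)$ put $$\mathcal E(\Gamma,q,y)=\sum_{E'\subseteq E(\Gamma)\text{ even}}(-1)^{q([E'])}\prod_{e\in E'}y_e .$$ **Gluing variables.** Let $R$ be a commutative ring and $x_e\in R$ for $e\in E(G)$ (for instance, indeterminates). Let $\Lambda$ be the exterior algebra over $R$ on $e_1^1<e_2^1<\dots<e_1^k<e_2^k$ and $\Lambda^*$ the one on the dual variables $e_2^{k*},e_1^{k*},\dots,e_2^{1*},e_1^{1*}$. Let $\langle\cdot,\cdot\rangle:\Lambda\times\Lambda^*\to R$ be the $R$-bilinear pairing for which the basis of increasing monomials $e^{i_1}_{\epsilon_1}\cdots e^{i_\ell}_{\epsilon_\ell}$ of $\Lambda$ and the basis of reversed monomials $e^{i_\ell *}_{\epsilon_\ell}\cdots e^{i_1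 *}_{\epsilon_1}$ of $\Lambda^*$ are dual to each other. The variables $y_1$ of $G_1^S$ are $x_e$ on $G_1$, $e_1^i$ on the inner edge and $e_2^i$ on the outer edge of the $i$-th leg; the variables $y_2$ of $G_2^S$ are $x_e$ on $G_2$, $e_2^{i*}$ on the inner edge and $e_1^{i*}$ on the outer edge of the $i$-th leg. Products of gluing variables are taken in the order $e_1^1,e_2^1,\dots,e_1^k,e_2^k$ for $G_1^S$ and $e_2^{k*},e_1^{k*},\dots,e_2^{1*},e_1^{1*}$ for $G_2^S$. **Theorem.** For every quadratic form $q$ on $H_1(X;\mathbb F_2)$ and $j=1,2$ there is exactly one quadratic form $q_j$ on $H_1(X_j;\mathbb F_2)$ that agrees with $q$ on the classes of all mod 2 cycles (of the 1-skeleton) lying in $T_j$, and with these forms $$\mathcal E(G,q,x)=\big\langle \mathcal E(G_1^S,q_1,y_1),\ \mathcal E(G_2^S,q_2,y_2)\big\rangle .$$ -/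

import Mathlib

/-!
Closed oriented surfaces with a finite cell decomposition, graphs drawn in their 1-skeleton,
mod 2 homology with its intersection form, the operation of capping off one side of a separating
curve by a disc that carries the target, and the exterior algebra of gluing variables.
-/

noncomputable section

namespace IsingGluing

/-! ### Cell decompositions of closed oriented surfaces -/

/-- A dart is an edge together with one of its two directions. -/
abbrev Dart (E : Type*) := E × Bool

/-- Reversal of a dart. -/
def Dart.flip {E : Type*} (d : Dart E) : Dart E := (d.1, !d.2)

/-- A closed oriented surface together with a finite cell decomposition with edge set `E`
(loops and multiple edges are allowed), encoded by its rotation system: `rot d` is the dart that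
follows `d` in counterclockwise order around the initial vertex of `d`. -/
structure CellSurface (E : Type*) where
  rot : Equiv.Perm (Dart E)

namespace CellSurface

variable {E : Type*} (M : CellSurface E)

/-- Reversal of darts, as a permutation. -/
def flipPerm (E : Type*) : Equiv.Perm (Dart E) where
  toFun := Dart.flip
  invFun := Dart.flip
  left_inv d := by simp [Dart.flip]
  right_inv d := by simp [Dart.flip]

/-- The dart that follows `d` on the boundary of the face lying to the left of `d`. -/
def next : Equiv.Perm (Dart E) := M.rot⁻¹ * flipPerm E

/-- Vertices are the cycles of the rotation. -/
def Vertex : Type _ := Quotient (Equiv.Perm.SameCycle.setoid M.rot)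

/-- Faces are the cycles of `next`. -/
def Face : Type _ := Quotient (Equiv.Perm.SameCycle.setoid M.next)

/-- The initial vertex of a dart. -/
def tail (d : Dart E) : M.Vertex := Quotient.mk _ d

/-- The face to the left of a dart. -/
def leftFace (d : Dart E) : M.Face := Quotient.mk _ d

instance [Finite E] : Finite M.Vertex := by unfold Vertex; infer_instance

instance [Finite E] : Finite M.Face := by unfold Face; infer_instance

instance [Finite E] : Fintype M.Vertex := Fintype.ofFinite _

instance [Finite E] : Fintype M.Face := Fintype.ofFinite _

/-- The Euler characteristic `V - E + F`. -/
def eulerChar : ℤ := (Nat.card M.Vertex : ℤ) - Nat.card E + Nat.card M.Face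

/-- The surface is connected. -/
def IsConnected : Prop :=
  ∀ d d' : Dart E, Relation.ReflTransGen (fun a b => b = M.rot a ∨ b = a.flip) d d'

/-- The surface is a double torus: connected (and oriented) of Euler characteristic `-2`. -/
def IsDoubleTorus : Prop := M.IsConnected ∧ M.eulerChar = -2

/-! ### Homology mod 2 -/

theorem tail_rot (d : Dart E) : M.tail (M.rot d) = M.tail d :=
  Quotient.sound (s := Equiv.Perm.SameCycle.setoid M.rot) ⟨-1, by simp⟩

/-- A dart with given initial vertex. -/
def rep (v : M.Vertex) : Dart E := Quotient.out (s := Equiv.Perm.SameCycle.setoid M.rot) v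

theorem tail_rep (v : M.Vertex) : M.tail (M.rep v) = v :=
  Quotient.out_eq (s := Equiv.Perm.SameCycle.setoid M.rot) v

theorem leftFace_next (d : Dart E) : M.leftFace (M.next d) = M.leftFace d :=
  Quotient.sound (s := Equiv.Perm.SameCycle.setoid M.next) ⟨-1, by simp⟩

theorem leftFace_flip_rot (d : Dart E) : M.leftFace (M.rot d).flip = M.leftFace d := by
  rw [← M.leftFace_next]
  simp [next, flipPerm, Dart.flip]

section Homology

variable [Fintype E]

open scoped Classical in
/-- The cellular boundary map from 1-chains to 0-chains. -/
def boundaryOne : (E → ZMod 2) →ₗ[ZMod 2] (M.Vertex → ZMod 2) where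
  toFun a v := ∑ d : Dart E with M.tail d = v, a d.1
  map_add' a b := by ext v; simp [Finset.sum_add_distrib]
  map_smul' c a := by ext v; simp [Finset.mul_sum]

/-- The cellular boundary map from 2-chains to 1-chains. -/
def boundaryTwo : (M.Face → ZMod 2) →ₗ[ZMod 2] (E → ZMod 2) where
  toFun f e := f (M.leftFace (e, true)) + f (M.leftFace (e, false))
  map_add' f g := by ext e; simp only [Pi.add_apply]; ring
  map_smul' c f := by ext e; simp [mul_add]

/-- The 1-cycles. -/
abbrev Cycles : Submodule (ZMod 2) (E → ZMod 2) := LinearMap.ker M.boundaryOne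

/-- The first homology group of the surface with coefficients in the field of two elements. -/
abbrev H1 : Type _ :=
  M.Cycles ⧸ (LinearMap.range M.boundaryTwo).submoduleOf M.Cycles

/-- The homology class of a cycle. -/
def homologyClass (a : E → ZMod 2) (ha : a ∈ M.Cycles) : M.H1 :=
  Submodule.Quotient.mk ⟨a, ha⟩

theorem boundaryTwo_apply_dart (f : M.Face → ZMod 2) (d : Dart E) :
    M.boundaryTwo f d.1 = f (M.leftFace d) + f (M.leftFace d.flip) := by
  obtain ⟨e, b⟩ := d
  cases b
  · simp [boundaryTwo, Dart.flip, add_comm]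
  · simp [boundaryTwo, Dart.flip]

theorem boundaryTwo_mem_cycles (f : M.Face → ZMod 2) : M.boundaryTwo f ∈ M.Cycles := by
  classical
  rw [LinearMap.mem_ker]
  ext v
  change ∑ d : Dart E with M.tail d = v, M.boundaryTwo f d.1 = 0
  simp_rw [boundaryTwo_apply_dart, Finset.sum_add_distrib, Finset.sum_filter]
  have h : ∑ d : Dart E, (if M.tail d = v then f (M.leftFace d.flip) else 0)
      = ∑ d : Dart E, (if M.tail d = v then f (M.leftFace d) else 0) := by
    rw [← Equiv.sum_comp M.rot]
    simp_rw [tail_rot, leftFace_flip_rot]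
  rw [h]
  exact CharTwo.add_self_eq_zero _

/-! ### The intersection form

A 1-cycle `a` is pushed off the 1-skeleton: every edge of `a` is replaced by a nearby strand
which leaves both end vertices of the edge on the left hand side of the respective dart (so that
it crosses the edge once, in the middle), and near every vertex the ends of these strands are
joined by arcs around the vertex. A potential of `a` records how often, mod 2, these arcs cross a
dart. The intersection number of `a` with a 1-cycle `b` is the number of crossings mod 2 of the
pushed off cycle with the edges of `b`. -/

/-- `p d` is the number mod 2 of arcs that cross the dart `d`; the number changes exactly at the
strand ends in the corner between `d` and `rot d`. -/
def IsPotential (a : E → ZMod 2) (p : Dart E → ZMod 2) : Prop :=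
  ∀ d, p (M.rot d) = p d + a d.1

theorem exists_isPotential (a : E → ZMod 2) (ha : a ∈ M.Cycles) : ∃ p, M.IsPotential a p := by
  classical
  have hb : ∀ d : Dart E, ∃ n : ℕ, (M.rot ^ n) (M.rep (M.tail d)) = d := by
    intro d
    have h : M.rot.SameCycle (M.rep (M.tail d)) d :=
      Quotient.mk_out (s := Equiv.Perm.SameCycle.setoid M.rot) d
    obtain ⟨n, -, hn⟩ := h.exists_pow_eq'
    exact ⟨n, hn⟩
  have hb' : ∀ d : Dart E, ∃ n : ℕ, (M.rot ^ n) (M.rep (M.tail d)) = d ∧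
      ∀ m < n, (M.rot ^ m) (M.rep (M.tail d)) ≠ d :=
    fun d => ⟨Nat.find (hb d), Nat.find_spec (hb d), fun _ hm => Nat.find_min (hb d) hm⟩
  choose N hN hNmin using hb'
  refine ⟨fun d => ∑ i ∈ Finset.range (N d), a ((M.rot ^ i) (M.rep (M.tail d))).1,
    fun d => ?_⟩
  have hx := hN d
  have hmin := hNmin d
  have hx' := hN (M.rot d)
  have hmin' := hNmin (M.rot d)
  simp only [M.tail_rot] at hx' hmin' ⊢
  generalize N d = n at hx hmin ⊢
  generalize N (M.rot d) = n' at hx' hmin' ⊢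
  set b := M.rep (M.tail d) with hbdef
  have hle : n' ≤ n + 1 := by
    by_contra hlt
    exact hmin' (n + 1) (by omega) (by rw [pow_succ', Equiv.Perm.mul_apply, hx])
  have hsum : ∑ i ∈ Finset.range n, a ((M.rot ^ i) b).1 + a d.1
      = ∑ i ∈ Finset.range (n + 1), a ((M.rot ^ i) b).1 := by
    rw [Finset.sum_range_succ, hx]
  rw [hsum]
  rcases hle.eq_or_lt with heq | hlt
  · rw [heq]
  have h0 : n' = 0 := by
    by_contra hne
    obtain ⟨m, hm⟩ := Nat.exists_eq_succ_of_ne_zero hne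
    apply hmin m (by omega)
    apply M.rot.injective
    rw [← Equiv.Perm.mul_apply, ← pow_succ', ← Nat.succ_eq_add_one, ← hm, hx']
  rw [h0] at hx' ⊢
  rw [Finset.sum_range_zero]
  have hper : (M.rot ^ (n + 1)) b = b := by
    rw [pow_succ', Equiv.Perm.mul_apply, hx, ← hx']; rfl
  have hcyc : ∑ d' : Dart E with M.tail d' = M.tail d, a d'.1 = 0 :=
    congrFun (LinearMap.mem_ker.mp ha) (M.tail d)
  rw [← hcyc]
  symm
  refine Finset.sum_nbij (fun i => (M.rot ^ i) b) ?_ ?_ ?_ (fun _ _ => rfl)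
  · intro i _
    simp only [Finset.mem_filter, Finset.mem_univ, true_and]
    have hi : M.tail ((M.rot ^ i) b) = M.tail b := by
      induction i with
      | zero => rfl
      | succ i ih =>
        rw [pow_succ', Equiv.Perm.mul_apply, M.tail_rot]
        exact ih (by simp_all; omega)
    rw [hi, hbdef]
    exact M.tail_rep (M.tail d)
  · have key : ∀ i j : ℕ, i < j → j < n + 1 → (M.rot ^ i) b ≠ (M.rot ^ j) b := by
      intro i j hij hj h
      apply hmin (n - (j - i)) (by omega)
      have e1 : n - (j - i) = (n - j) + i := by omega
      have e2 : n = (n - j) + j := by omega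
      rw [e1, pow_add, Equiv.Perm.mul_apply, h, ← Equiv.Perm.mul_apply, ← pow_add, ← e2, hx]
    intro i hi j hj h
    simp only [Finset.coe_range, Set.mem_Iio] at hi hj
    rcases lt_trichotomy i j with hij | hij | hij
    · exact absurd h (key i j hij hj)
    · exact hij
    · exact absurd h.symm (key j i hij hi)
  · intro d' hd'
    simp only [Finset.coe_filter, Finset.mem_univ, true_and, Set.mem_ofPred_eq] at hd'
    obtain ⟨m, hm⟩ := hb d'
    rw [hd'] at hm
    refine ⟨m % (n + 1), ?_, ?_⟩
    · simp only [Finset.coe_range, Set.mem_Iio]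
      exact Nat.mod_lt _ (Nat.succ_pos _)
    · change (M.rot ^ (m % (n + 1))) b = d'
      have hq : ∀ q : ℕ, ((M.rot ^ (n + 1)) ^ q) b = b := by
        intro q
        induction q with
        | zero => rfl
        | succ q ih => rw [pow_succ, Equiv.Perm.mul_apply, hper, ih]
      rw [← hm]
      conv_rhs => rw [← Nat.mod_add_div m (n + 1)]
      rw [pow_add, Equiv.Perm.mul_apply, pow_mul, hq]

/-- A potential of the cycle `a`. -/
def potential (a : M.Cycles) : Dart E → ZMod 2 :=
  Classical.choose (M.exists_isPotential a.1 a.2)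

theorem isPotential_potential (a : M.Cycles) : M.IsPotential a.1 (M.potential a) :=
  Classical.choose_spec (M.exists_isPotential a.1 a.2)

/-- The number of crossings mod 2 of the pushed off cycle `a` with the edges of `b`: the edge `e`
is crossed by the arcs around its two end vertices, and once more if it belongs to `a`. -/
def crossing (a : E → ZMod 2) (p : Dart E → ZMod 2) (b : E → ZMod 2) : ZMod 2 :=
  ∑ e : E, (p (e, true) + p (e, false) + a e) * b e

theorem crossing_eq (a : E → ZMod 2) (p : Dart E → ZMod 2) (b : E → ZMod 2) :
    crossing a p b = ∑ d : Dart E, p d * b d.1 + ∑ e : E, a e * b e := by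
  rw [crossing, Fintype.sum_prod_type, ← Finset.sum_add_distrib]
  refine Finset.sum_congr rfl fun e _ => ?_
  rw [Fintype.sum_bool]
  ring

theorem sum_mul_eq_zero (p : Dart E → ZMod 2) (hp : ∀ d, p (M.rot d) = p d)
    (b : M.Cycles) : ∑ d : Dart E, p d * b.1 d.1 = 0 := by
  classical
  have hpow : ∀ d d', M.tail d = M.tail d' → p d = p d' := by
    intro d d' h
    have hs : M.rot.SameCycle d d' :=
      Quotient.exact (s := Equiv.Perm.SameCycle.setoid M.rot) h
    obtain ⟨n, -, hn⟩ := hs.exists_pow_eq'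
    rw [← hn]
    clear hn
    induction n with
    | zero => rfl
    | succ n ih => rw [pow_succ', Equiv.Perm.mul_apply, hp]; exact ih
  rw [← Finset.sum_fiberwise Finset.univ M.tail]
  refine Finset.sum_eq_zero fun v _ => ?_
  have hcyc : ∑ d' : Dart E with M.tail d' = v, b.1 d'.1 = 0 :=
    congrFun (LinearMap.mem_ker.mp b.2) v
  rw [Finset.sum_congr rfl (g := fun d => p (M.rep v) * b.1 d.1), ← Finset.mul_sum, hcyc,
    mul_zero]
  intro d hd
  rw [hpow d (M.rep v) (by rw [(Finset.mem_filter.mp hd).2, M.tail_rep])]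

theorem crossing_congr (a : E → ZMod 2) (p p' : Dart E → ZMod 2) (hp : M.IsPotential a p)
    (hp' : M.IsPotential a p') (b : M.Cycles) : crossing a p b.1 = crossing a p' b.1 := by
  have h := M.sum_mul_eq_zero (fun d => p d - p' d)
    (fun d => by rw [hp d, hp' d]; ring) b
  simp only [sub_mul, Finset.sum_sub_distrib] at h
  rw [crossing_eq, crossing_eq, sub_eq_zero.mp h]

/-- The intersection number mod 2 of two cycles. -/
def crossingForm : M.Cycles →ₗ[ZMod 2] M.Cycles →ₗ[ZMod 2] ZMod 2 :=
  LinearMap.mk₂ (ZMod 2) (fun a b => crossing a.1 (M.potential a) b.1)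
    (fun a a' b => by
      rw [M.crossing_congr _ _ (M.potential a + M.potential a') (M.isPotential_potential _)
        (fun d => by
          simp only [Pi.add_apply, M.isPotential_potential a d, M.isPotential_potential a' d,
            Submodule.coe_add]
          ring) b]
      simp only [crossing, ← Finset.sum_add_distrib]
      refine Finset.sum_congr rfl fun e _ => ?_
      simp only [Pi.add_apply, Submodule.coe_add]
      ring)
    (fun c a b => by
      rw [M.crossing_congr _ _ (c • M.potential a) (M.isPotential_potential _)
        (fun d => by
          simp only [Pi.smul_apply, smul_eq_mul, M.isPotential_potential a d, Submodule.coe_smul]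
          ring) b]
      simp only [crossing, smul_eq_mul, Finset.mul_sum]
      refine Finset.sum_congr rfl fun e _ => ?_
      simp only [Pi.smul_apply, smul_eq_mul, Submodule.coe_smul]
      ring)
    (fun a b b' => by
      simp only [crossing, ← Finset.sum_add_distrib]
      refine Finset.sum_congr rfl fun e _ => ?_
      simp only [Pi.add_apply, Submodule.coe_add]
      ring)
    (fun c a b => by
      simp only [crossing, smul_eq_mul, Finset.mul_sum]
      refine Finset.sum_congr rfl fun e _ => ?_
      simp only [Pi.smul_apply, smul_eq_mul, Submodule.coe_smul]
      ring)

theorem crossingForm_apply (a b : M.Cycles) :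
    M.crossingForm a b = crossing a.1 (M.potential a) b.1 := rfl

theorem crossingForm_boundary_left (a b : M.Cycles)
    (ha : a ∈ (LinearMap.range M.boundaryTwo).submoduleOf M.Cycles) :
    M.crossingForm a b = 0 := by
  obtain ⟨a, ha'⟩ := a
  obtain ⟨f, hf⟩ : ∃ f, M.boundaryTwo f = a := ha
  subst hf
  rw [crossingForm_apply, M.crossing_congr _ _ (fun d => f (M.leftFace d.flip))
    (M.isPotential_potential _) (fun d => by
      change f (M.leftFace (M.rot d).flip) = f (M.leftFace d.flip) + M.boundaryTwo f d.1
      rw [leftFace_flip_rot, boundaryTwo_apply_dart, add_left_comm,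
        CharTwo.add_self_eq_zero, add_zero]) b]
  refine Finset.sum_eq_zero fun e _ => ?_
  simp only [boundaryTwo, Dart.flip, LinearMap.coe_mk, AddHom.coe_mk, Bool.not_true,
    Bool.not_false]
  rw [add_comm (f (M.leftFace (e, false))), CharTwo.add_self_eq_zero, zero_mul]

theorem crossingForm_boundary_right (a b : M.Cycles)
    (hb : b ∈ (LinearMap.range M.boundaryTwo).submoduleOf M.Cycles) :
    M.crossingForm a b = 0 := by
  obtain ⟨b, hb'⟩ := b
  obtain ⟨f, hf⟩ : ∃ f, M.boundaryTwo f = b := hb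
  subst hf
  have hp := M.isPotential_potential a
  rw [crossingForm_apply, crossing_eq]
  set p := M.potential a
  have h1 : ∑ e : E, a.1 e * M.boundaryTwo f e = ∑ d : Dart E, a.1 d.1 * f (M.leftFace d) := by
    rw [Fintype.sum_prod_type]
    refine Finset.sum_congr rfl fun e _ => ?_
    rw [Fintype.sum_bool, ← mul_add]
    rfl
  have h2 : ∑ d : Dart E, p d * f (M.leftFace d.flip)
      = ∑ d : Dart E, (p d + a.1 d.1) * f (M.leftFace d) := by
    rw [← Equiv.sum_comp M.rot]
    simp_rw [leftFace_flip_rot, hp _]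
  simp_rw [boundaryTwo_apply_dart, mul_add, Finset.sum_add_distrib]
  rw [h1, h2]
  simp_rw [add_mul, Finset.sum_add_distrib]
  rw [← add_assoc, CharTwo.add_self_eq_zero, zero_add, CharTwo.add_self_eq_zero]

/-- The mod 2 intersection form on the first homology group. -/
def intersectionForm : M.H1 →ₗ[ZMod 2] M.H1 →ₗ[ZMod 2] ZMod 2 :=
  Submodule.liftQ _
    { toFun := fun a => Submodule.liftQ _ (M.crossingForm a)
        (fun b hb => M.crossingForm_boundary_right a b hb)
      map_add' := fun a a' => by
        apply Submodule.linearMap_qext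
        exact map_add M.crossingForm a a'
      map_smul' := fun c a => by
        apply Submodule.linearMap_qext
        exact map_smul M.crossingForm c a }
    (fun a ha => by
      rw [LinearMap.mem_ker]
      apply Submodule.linearMap_qext
      exact LinearMap.ext fun b => M.crossingForm_boundary_left a b ha)

theorem intersectionForm_homologyClass (a b : M.Cycles) (p : Dart E → ZMod 2)
    (hp : M.IsPotential a.1 p) :
    M.intersectionForm (M.homologyClass a.1 a.2) (M.homologyClass b.1 b.2)
      = crossing a.1 p b.1 :=
  M.crossing_congr a.1 _ p (M.isPotential_potential a) hp b

/-- Quadratic forms on the first homology group associated with the intersection form. -/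
def QuadForm : Type _ :=
  {q : M.H1 → ZMod 2 // ∀ x y, q (x + y) = q x + q y + M.intersectionForm x y}

/-! ### Even subsets of edges and their signed generating function -/

open scoped Classical in
/-- Every vertex has even degree in the graph with edge set `A` (a loop counts twice). -/
def IsEven (A : Finset E) : Prop :=
  ∀ v : M.Vertex, Even (Finset.card {d : Dart E | d.1 ∈ A ∧ M.tail d = v})

open scoped Classical in
/-- The 1-chain of a set of edges. -/
def chain (A : Finset E) : E → ZMod 2 := fun e => if e ∈ A then 1 else 0

theorem chain_mem_cycles {A : Finset E} (hA : M.IsEven A) : chain A ∈ M.Cycles := by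
  classical
  rw [LinearMap.mem_ker]
  ext v
  change ∑ d : Dart E with M.tail d = v, (if d.1 ∈ A then (1 : ZMod 2) else 0) = 0
  rw [← Finset.sum_filter, Finset.filter_filter, Finset.sum_const, nsmul_one]
  have h := hA v
  rw [Finset.filter_congr (fun d _ => and_comm)] at h
  exact (ZMod.natCast_eq_zero_iff_even).mpr (by convert h)

/-- The homology class of an even set of edges. -/
def evenClass (A : Finset E) (hA : M.IsEven A) : M.H1 :=
  M.homologyClass (chain A) (M.chain_mem_cycles hA)

open scoped Classical in
/-- The signed generating function of the even subsets of a set `G` of edges: the sum of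
`(-1) ^ q [A] * w A` over all even `A ⊆ G`, where `w A` is the monomial of `A`. -/
def signedEvenSum {S : Type*} [Ring S] (G : Finset E) (q : M.QuadForm) (w : Finset E → S) : S :=
  ∑ A : {A : Finset E // A ⊆ G ∧ M.IsEven A}, (-1) ^ (q.1 (M.evenClass A.1 A.2.2)).val * w A.1

end Homology

/-! ### Deleting edges, and drawing the target into a face -/

/-- The first return map of a permutation of a finite set to a subset. -/
def firstReturn {α : Type*} [Finite α] (σ : Equiv.Perm α) (S : Set α) : Equiv.Perm S := by
  classical
  exact
  have h : ∀ x : S, ∃ n : ℕ, 0 < n ∧ (σ ^ n) x.1 ∈ S := fun x =>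
    ⟨orderOf σ, orderOf_pos σ, by rw [pow_orderOf_eq_one]; exact x.2⟩
  Equiv.ofBijective (fun x => (⟨(σ ^ Nat.find (h x)) x.1, (Nat.find_spec (h x)).2⟩ : S))
    (Finite.injective_iff_bijective.mp (by
      have key : ∀ x y : S, Nat.find (h x) ≤ Nat.find (h y) →
          (σ ^ Nat.find (h x)) x.1 = (σ ^ Nat.find (h y)) y.1 → x = y := by
        intro x y hle hxy
        have e : Nat.find (h y) = Nat.find (h x) + (Nat.find (h y) - Nat.find (h x)) := by omega
        rw [e, pow_add, Equiv.Perm.mul_apply] at hxy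
        have hxy' := (σ ^ Nat.find (h x)).injective hxy
        rcases Nat.eq_zero_or_pos (Nat.find (h y) - Nat.find (h x)) with h0 | h0
        · rw [h0, pow_zero] at hxy'
          exact Subtype.ext hxy'
        · refine absurd ⟨h0, hxy' ▸ x.2⟩ (Nat.find_min (h y) ?_)
          have := (Nat.find_spec (h x)).1
          omega
      intro x y hxy
      have hxy' := congrArg Subtype.val hxy
      rcases le_total (Nat.find (h x)) (Nat.find (h y)) with hle | hle
      · exact key x y hle hxy'
      · exact (key y x hle hxy'.symm).symm))

/-- The darts of a set `P` of edges. -/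
def dartEquiv (P : Set E) : Dart P ≃ {d : Dart E | d.1 ∈ P} where
  toFun d := ⟨(d.1.1, d.2), d.1.2⟩
  invFun d := (⟨d.1.1, d.2⟩, d.1.2)
  left_inv _ := rfl
  right_inv _ := rfl

/-- The cell decomposition that is spanned by a set `P` of edges: the rotation at each vertex is
the cyclic order induced on the darts of `P`, and a disc is glued to every boundary walk. -/
def restrict [Finite E] (P : Set E) : CellSurface P where
  rot := (dartEquiv P).symm.permCongr (firstReturn M.rot {d : Dart E | d.1 ∈ P})

/-- The edges of the target with `k` legs. `Sum.inl i` is the inner edge of the `i`-th leg, which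
joins the centre to the middle vertex of the leg; `Sum.inr i` is the outer edge, which joins
the middle vertex to the end vertex of the leg. -/
abbrev TargetEdge (k : ℕ) := Fin k ⊕ Fin k

/-- The rotation of the target, drawn in the plane so that the `r i`-th leg follows the `i`-th leg
counterclockwise around the centre. The darts with value `true` point away from the centre. -/
def targetRot {k : ℕ} (r : Equiv.Perm (Fin k)) : Equiv.Perm (Dart (TargetEdge k)) where
  toFun
    | (Sum.inl i, true) => (Sum.inl (r i), true)
    | (Sum.inl i, false) => (Sum.inr i, true)
    | (Sum.inr i, true) => (Sum.inl i, false)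
    | (Sum.inr i, false) => (Sum.inr i, false)
  invFun
    | (Sum.inl i, true) => (Sum.inl (r.symm i), true)
    | (Sum.inl i, false) => (Sum.inr i, true)
    | (Sum.inr i, true) => (Sum.inl i, false)
    | (Sum.inr i, false) => (Sum.inr i, false)
  left_inv := by rintro ⟨i | i, _ | _⟩ <;> simp
  right_inv := by rintro ⟨i | i, _ | _⟩ <;> simp

/-- The rotation of the disjoint union. -/
def sumRot {F : Type*} (σ : Equiv.Perm (Dart E)) (τ : Equiv.Perm (Dart F)) :
    Equiv.Perm (Dart (E ⊕ F)) :=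
  (Equiv.sumProdDistrib E F Bool).symm.permCongr (Equiv.sumCongr σ τ)

open scoped Classical in
/-- The target with `k` legs is drawn into a face, the end vertex of its `j`-th leg being
identified with the initial vertex of the dart `corner j`; the leg arrives there between the
darts `corner j` and `rot (corner j)`. -/
def attachTarget {k : ℕ} (corner : Fin k → Dart E) (r : Equiv.Perm (Fin k)) :
    CellSurface (E ⊕ TargetEdge k) where
  rot := sumRot M.rot (targetRot r) *
    (List.ofFn fun j : Fin k =>
      Equiv.swap ((Sum.inl (corner j).1, (corner j).2) : Dart (E ⊕ TargetEdge k))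
        (Sum.inr (Sum.inr j), false)).prod

/-! ### Separating curves and embedded graphs -/

/-- The edges that lie in the closure of the region formed by a set `S` of faces. -/
def closedEdges (S : Set M.Face) : Set E :=
  {e | M.leftFace (e, true) ∈ S ∨ M.leftFace (e, false) ∈ S}

/-- The Euler characteristic of the closure of the region formed by a set `S` of faces. -/
def regionEulerChar (S : Set M.Face) : ℤ :=
  ({v : M.Vertex | ∃ d, M.tail d = v ∧ M.leftFace d ∈ S}.ncard : ℤ)
    - (M.closedEdges S).ncard + S.ncard

/-- The interior of the region formed by a set `S` of faces is connected. -/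
def RegionConnected (S : Set M.Face) : Prop :=
  ∀ f ∈ S, ∀ g ∈ S, Relation.ReflTransGen
    (fun a b => b ∈ S ∧ ∃ d, M.leftFace d = a ∧ M.leftFace d.flip = b) f g

/-- A simple closed oriented curve `C`, running along the 1-skeleton, whose complement has exactly
two components, one to the left and one to the right of `C`, such that the closure of each of
them is a torus with an open disc bounded by `C` cut out. -/
structure SeparatingCurve where
  /-- The number of edges of the curve. -/
  length : ℕ
  length_pos : NeZero length
  /-- The edges of the curve in cyclic order, directed along the curve. -/
  dart : Fin length → Dart E
  closed : ∀ i, M.tail (dart (i + 1)) = M.tail (dart i).flip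
  simple : Function.Injective fun i => M.tail (dart i)
  /-- The faces to the left of the curve. -/
  left : Set M.Face
  /-- One changes from the left side to the right side exactly by crossing the curve. -/
  mem_range_dart_iff : ∀ d,
    d ∈ Set.range dart ↔ M.leftFace d ∈ left ∧ M.leftFace d.flip ∉ left
  left_connected : M.RegionConnected left
  right_connected : M.RegionConnected leftᶜ
  left_eulerChar : M.regionEulerChar left = -1
  right_eulerChar : M.regionEulerChar leftᶜ = -1

/-- A graph embedded in the surface as a subgraph of the 1-skeleton. -/
structure EmbeddedGraph where
  verts : Set M.Vertex
  edges : Finset E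
  tail_mem : ∀ e ∈ edges, ∀ b, M.tail (e, b) ∈ verts

variable {M}

/-- The curve meets the graph in vertices only. -/
def SeparatingCurve.MeetsInVertices (C : M.SeparatingCurve) (G : M.EmbeddedGraph) : Prop :=
  ∀ i, (C.dart i).1 ∉ G.edges

namespace SeparatingCurve

variable (C : M.SeparatingCurve) (G : M.EmbeddedGraph)

theorem mem_left (i : Fin C.length) : (C.dart i).1 ∈ M.closedEdges C.left := by
  have h := ((C.mem_range_dart_iff (C.dart i)).mp ⟨i, rfl⟩).1
  generalize C.dart i = d at h ⊢
  obtain ⟨e, b⟩ := d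
  cases b
  · exact Or.inr h
  · exact Or.inl h

theorem mem_right (i : Fin C.length) : (C.dart i).1 ∈ M.closedEdges C.leftᶜ := by
  have h := ((C.mem_range_dart_iff (C.dart i)).mp ⟨i, rfl⟩).2
  generalize C.dart i = d at h ⊢
  obtain ⟨e, b⟩ := d
  cases b
  · exact Or.inl h
  · exact Or.inr h

open scoped Classical in
/-- The positions along the curve of the vertices of the graph that lie on the curve. -/
def positions : Finset (Fin C.length) := {i | M.tail (C.dart i) ∈ G.verts}

/-- The number `k` of vertices of the graph on the curve. -/
def numGluing : ℕ := (C.positions G).card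

/-- The dart of the curve that starts at the `j`-th vertex of the graph on the curve, in the order
along the curve from its chosen starting point. -/
def gluingPos (j : Fin (C.numGluing G)) : Fin C.length := (C.positions G).orderEmbOfFin rfl j

/-- The first torus: the closure of the left side of the curve, capped off by a disc. -/
def leftCap [Finite E] : CellSurface (M.closedEdges C.left) := M.restrict _

/-- The second torus: the closure of the right side of the curve, capped off by a disc. -/
def rightCap [Finite E] : CellSurface (M.closedEdges C.leftᶜ) := M.restrict _

/-- The first torus with the target drawn in the capping disc, its `j`-th leg ending at the `j`-th
vertex on the curve. The capping disc lies to the right of the curve, hence its corner at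
that vertex precedes the outgoing dart of the curve, and the legs appear in the order opposite
to the one along the curve when one turns counterclockwise around the centre. -/
def leftTorus [Finite E] :
    CellSurface (M.closedEdges C.left ⊕ TargetEdge (C.numGluing G)) :=
  C.leftCap.attachTarget
    (fun j => C.leftCap.rot⁻¹ (⟨(C.dart (C.gluingPos G j)).1, C.mem_left _⟩,
      (C.dart (C.gluingPos G j)).2))
    (finRotate _)⁻¹

/-- The second torus with the target drawn in the capping disc, its `j`-th leg ending at the
`j`-th vertex on the curve. The capping disc lies to the left of the curve, hence its corner at
that vertex follows the outgoing dart of the curve, and the legs appear in the order along the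
curve when one turns counterclockwise around the centre. -/
def rightTorus [Finite E] :
    CellSurface (M.closedEdges C.leftᶜ ⊕ TargetEdge (C.numGluing G)) :=
  C.rightCap.attachTarget
    (fun j => (⟨(C.dart (C.gluingPos G j)).1, C.mem_right _⟩, (C.dart (C.gluingPos G j)).2))
    (finRotate _)

end SeparatingCurve

open scoped Classical in
/-- The edges of the graph obtained from the part of `G` inside the edge set `P` by attaching the
target with `k` legs. -/
def EmbeddedGraph.withTarget [Fintype E] (G : M.EmbeddedGraph) (P : Set E) (k : ℕ) :
    Finset (P ⊕ TargetEdge k) :=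
  Finset.univ.filter fun e => ∀ e' : P, e = Sum.inl e' → e'.1 ∈ G.edges

open scoped Classical in
/-- Extension by zero of a chain on the edge set `P` to the whole 1-skeleton. -/
def extendChain {P : Set E} (a : P → ZMod 2) : E → ZMod 2 :=
  fun e => if h : e ∈ P then a ⟨e, h⟩ else 0

/-- Extension by zero of a chain on the edge set `P` to the target. -/
def extendToTarget {P : Set E} {k : ℕ} (a : P → ZMod 2) : P ⊕ TargetEdge k → ZMod 2 :=
  Sum.elim a (fun _ => 0)

open scoped Classical in
/-- `q'` is the restriction of the quadratic form `q`: the two forms agree on the homology classes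
of all cycles that are supported in the common part `P` of both surfaces. -/
def IsRestriction [Fintype E] {P : Set E} {k : ℕ} (q : M.QuadForm)
    (N : CellSurface (P ⊕ TargetEdge k)) (q' : N.QuadForm) : Prop :=
  ∀ (a : P → ZMod 2) (h : extendChain a ∈ M.Cycles) (h' : extendToTarget a ∈ N.Cycles),
    q'.1 (N.homologyClass (extendToTarget a) h') = q.1 (M.homologyClass (extendChain a) h)

end CellSurface

/-! ### The exterior algebra of gluing variables -/

section Exterior

variable (R : Type*) [CommRing R] (k : ℕ)

/-- Indices of the gluing variables, in the order `(1,1) < (1,2) < (2,1) < ... < (k,1) < (k,2)`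
(both components are counted from `0` here). -/
abbrev GluingIndex := Fin k ×ₗ Fin 2

/-- The exterior algebra of the gluing variables. -/
abbrev GluingAlgebra := ExteriorAlgebra R (GluingIndex k → R)

/-- The dual exterior algebra. -/
abbrev DualGluingAlgebra := ExteriorAlgebra R (Module.Dual R (GluingIndex k → R))

/-- The vectors underlying the gluing variables. -/
def gluingBasis : Module.Basis (GluingIndex k) R (GluingIndex k → R) := Pi.basisFun R _

/-- The dual basis, with its indices in decreasing order. -/
def dualGluingBasis :
    Module.Basis (GluingIndex k)ᵒᵈ R (Module.Dual R (GluingIndex k → R)) :=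
  (gluingBasis R k).dualBasis.reindex OrderDual.toDual

variable {R k}

/-- The gluing variable with indices `i` and `ε`. -/
def gluingVar (i : Fin k) (ε : Fin 2) : GluingAlgebra R k :=
  ExteriorAlgebra.ι R (gluingBasis R k (toLex (i, ε)))

/-- The dual gluing variable with indices `i` and `ε`. -/
def dualGluingVar (i : Fin k) (ε : Fin 2) : DualGluingAlgebra R k :=
  ExteriorAlgebra.ι R (dualGluingBasis R k (OrderDual.toDual (toLex (i, ε))))

/-- The scalar product: the basis monomials of the exterior algebra are the products of gluing
variables in increasing order, those of the dual algebra are the products of dual gluing variables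
in decreasing order, and these two bases are dual to each other. -/
def scalarProduct (Y : GluingAlgebra R k) (Z : DualGluingAlgebra R k) : R :=
  ∑ b : Finset (GluingIndex k), (gluingBasis R k).ExteriorAlgebra.repr Y b *
    (dualGluingBasis R k).ExteriorAlgebra.repr Z (b.map OrderDual.toDual.toEmbedding)

/-- The variables of the first graph on the target: `e i 1` on the inner edge and `e i 2` on the
outer edge of the `i`-th leg. -/
def leftTargetVar : CellSurface.TargetEdge k → GluingAlgebra R k
  | Sum.inl i => gluingVar i 0
  | Sum.inr i => gluingVar i 1

/-- The variables of the second graph on the target: the dual of `e i 2` on the inner edge and the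
dual of `e i 1` on the outer edge of the `i`-th leg. -/
def rightTargetVar : CellSurface.TargetEdge k → DualGluingAlgebra R k
  | Sum.inl i => dualGluingVar i 1
  | Sum.inr i => dualGluingVar i 0

/-- The edges of the target leg by leg, in the order in which their variables
`e 1 1, e 1 2, ..., e k 1, e k 2` are listed in the first graph. -/
def leftOrder (k : ℕ) : List (CellSurface.TargetEdge k) :=
  (List.finRange k).flatMap fun i => [Sum.inl i, Sum.inr i]

/-- The edges of the target leg by leg, in the order in which their variables, the duals of
`e k 2, e k 1, ..., e 1 2, e 1 1`, are listed in the second graph. -/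
def rightOrder (k : ℕ) : List (CellSurface.TargetEdge k) :=
  (List.finRange k).reverse.flatMap fun i => [Sum.inl i, Sum.inr i]

open scoped Classical in
/-- The monomial of a set `A` of edges: the product of the scalar variables `x e` of its edges
outside the target and of the variables `y t` of its target edges, taken in the order `l`. -/
def gluingMonomial {E : Type*} [Fintype E] {S : Type*} [Ring S] [Algebra R S] {P : Set E}
    (x : E → R) (y : CellSurface.TargetEdge k → S) (l : List (CellSurface.TargetEdge k))
    (A : Finset (P ⊕ CellSurface.TargetEdge k)) : S :=
  algebraMap R S (∏ e : P with Sum.inl e ∈ A, x e.1) *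
    ((l.filter fun t => Sum.inr t ∈ A).map y).prod

end Exterior

end IsingGluing

end

/-!
The formula compares two ways of summing over even sets. An even set `A` of edges of `G` falls into
its left part `A₁` and its right part `A₂`, as no edge of `G` lies on the curve `C`. Both parts have
odd degree at the same vertices on `C`; let `I` be the set of the legs of the target that end there.
By the handshake lemma `I` has an even number of elements, so each `Aⱼ`, continued through both edges
of the legs in `I`, is an even set of the respective graph with target, and every even set of that
graph arises in this way, because the two edges of a leg meet in a vertex of degree two. The monomials
of two such sets are, up to their scalar parts, basis monomials of the exterior algebra and of its dual
with increasing, respectively decreasing, indices; they pair to `1` if the legs agree and to `0`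
otherwise (`scalarProduct_sum`, `indexSet_eq_iff`). Hence the pairing is the sum over even `A`, and it
remains to compare signs.

Let `K` be a set of edges of `C` that pairs up the end vertices of the legs in `I`, namely the arcs
after an odd number of these vertices (`partialSum`, `curveChain`). In the capped torus, `K` and the
legs in `I` together bound a union of sectors into which the target cuts the disc
(`IsCap.sum_elim_mem_range`), so that `q₁` takes the same value on `A₁` with its legs as `q` on
`A₁ + K`, and likewise on the right (`IsSide.restriction_apply`). Finally `A` is the sum of `A₁ + K`
and `A₂ + K`, which do not cross, as they lie on different sides of `C` (`intersectionForm_eq_zero`).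
Therefore `q A = q₁ (A₁ ∪ legs) + q₂ (A₂ ∪ legs)` (`quadForm_eq_add`).

The same sectors show that every cycle of the torus with target is homologous to one that avoids the
target. A cycle which avoids the target and bounds in that torus bounds in the double torus: the
2-chain is constant on the capping disc and may be assumed to vanish there
(`IsCap.extendChain_mem_range`). Since intersection numbers of cycles off the target are the same in
both surfaces (`intersectionForm_extendToTarget`), a quadratic form has exactly one restriction
(`existsUnique_quadratic`).

Cycles are handled through their potentials, and 2-chains through functions on darts that are constant
along faces. In these terms erasing edges and drawing the target only affect the rotation, and the
vertices and faces of the new surfaces need not be described.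
-/

noncomputable section

namespace IsingGluing

/-! ### Cycles, boundaries and quadratic forms in terms of darts -/

theorem eq_of_sameCycle {α β : Type*} [Finite α] {σ : Equiv.Perm α} {g : α → β}
    (hg : ∀ x, g (σ x) = g x) {x y : α} (h : σ.SameCycle x y) : g y = g x := by
  obtain ⟨n, -, rfl⟩ := h.exists_pow_eq'
  clear h
  induction n with
  | zero => rfl
  | succ n ih => rw [pow_succ', Equiv.Perm.mul_apply, hg, ih]

@[simp]
theorem Dart.flip_flip {E : Type*} (d : Dart E) : d.flip.flip = d := by
  simp [Dart.flip]

@[simp]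
theorem Dart.flip_fst {E : Type*} (d : Dart E) : d.flip.1 = d.1 := rfl

theorem Dart.eq_or_eq_flip {E : Type*} {d d' : Dart E} (h : d.1 = d'.1) :
    d = d' ∨ d = d'.flip := by
  obtain ⟨e, b⟩ := d
  obtain ⟨e', b'⟩ := d'
  obtain rfl : e = e' := h
  cases b <;> cases b' <;> simp [Dart.flip]

namespace CellSurface

variable {E : Type*} (M : CellSurface E)

/-- A function on darts that is constant along the boundary walk of each face. Such functions encode
the 2-chains: `(M.rot d).flip` precedes `d` on the boundary walk of the face to the left of `d`. -/
def FaceInvariant (g : Dart E → ZMod 2) : Prop := ∀ d, g (M.rot d).flip = g d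

/-- The boundary of a face-invariant function on darts, as a 1-chain. -/
def dartBoundary (g : Dart E → ZMod 2) : E → ZMod 2 := fun e => g (e, true) + g (e, false)

theorem dartBoundary_apply (g : Dart E → ZMod 2) (d : Dart E) :
    dartBoundary g d.1 = g d + g d.flip := by
  obtain ⟨e, b⟩ := d
  cases b
  · exact add_comm _ _
  · rfl

theorem tail_eq_iff {d d' : Dart E} : M.tail d = M.tail d' ↔ M.rot.SameCycle d d' :=
  ⟨fun h => Quotient.exact (s := Equiv.Perm.SameCycle.setoid M.rot) h,
    fun h => Quotient.sound (s := Equiv.Perm.SameCycle.setoid M.rot) h⟩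

section Finite

variable [Finite E]

theorem exists_face_function {g : Dart E → ZMod 2} (hg : M.FaceInvariant g) :
    ∃ f : M.Face → ZMod 2, ∀ d, f (M.leftFace d) = g d := by
  have hg' : ∀ d, g (M.next d) = g d := by
    intro d
    rw [← hg (M.next d)]
    simp [next, flipPerm]
  refine ⟨Quotient.lift (s := Equiv.Perm.SameCycle.setoid M.next) g ?_, fun d => rfl⟩
  intro a b hab
  exact (eq_of_sameCycle hg' hab).symm

theorem eq_of_tail_eq {β : Type*} {g : Dart E → β} {d d' : Dart E} (h : M.tail d = M.tail d')
    (hg : ∀ x, M.tail x = M.tail d → g (M.rot x) = g x) : g d' = g d := by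
  obtain ⟨n, -, rfl⟩ := (M.tail_eq_iff.mp h).exists_pow_eq'
  have key : ∀ n : ℕ, M.tail ((M.rot ^ n) d) = M.tail d ∧ g ((M.rot ^ n) d) = g d := by
    intro n
    induction n with
    | zero => exact ⟨rfl, rfl⟩
    | succ n ih =>
      rw [pow_succ', Equiv.Perm.mul_apply, M.tail_rot, hg _ ih.1]
      exact ih
  exact (key n).2

end Finite

variable [Fintype E]

theorem mem_range_boundaryTwo_iff {a : E → ZMod 2} :
    a ∈ LinearMap.range M.boundaryTwo ↔ ∃ g, M.FaceInvariant g ∧ dartBoundary g = a := by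
  constructor
  · rintro ⟨f, rfl⟩
    exact ⟨fun d => f (M.leftFace d), fun d => congrArg f (M.leftFace_flip_rot d), rfl⟩
  · rintro ⟨g, hg, rfl⟩
    obtain ⟨f, hf⟩ := M.exists_face_function hg
    refine ⟨f, funext fun e => ?_⟩
    change f _ + f _ = _
    rw [hf, hf, dartBoundary]

/-- The converse of `exists_isPotential`: the increments of a potential cancel around each vertex. -/
theorem mem_cycles_of_isPotential {a : E → ZMod 2} {p : Dart E → ZMod 2}
    (hp : M.IsPotential a p) : a ∈ M.Cycles := by
  classical
  rw [LinearMap.mem_ker]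
  ext v
  change ∑ d : Dart E with M.tail d = v, a d.1 = 0
  have h : ∀ d, a d.1 = p (M.rot d) - p d := fun d => by rw [hp d]; ring
  simp_rw [h, Finset.sum_sub_distrib, Finset.sum_filter]
  rw [sub_eq_zero, ← Equiv.sum_comp M.rot (fun d => if M.tail d = v then p d else 0)]
  simp_rw [tail_rot]

theorem boundaryOne_eq_zero_iff {a : E → ZMod 2} : M.boundaryOne a = 0 ↔ a ∈ M.Cycles :=
  LinearMap.mem_ker.symm

open scoped Classical in
theorem boundaryOne_apply (a : E → ZMod 2) (v : M.Vertex) :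
    M.boundaryOne a v = ∑ d : Dart E with M.tail d = v, a d.1 := rfl

/-- The handshake lemma. -/
theorem sum_boundaryOne (a : E → ZMod 2) : ∑ v, M.boundaryOne a v = 0 := by
  classical
  simp_rw [boundaryOne_apply, Finset.sum_filter]
  rw [Finset.sum_comm, Fintype.sum_prod_type]
  simp only [Finset.sum_ite_eq, Finset.mem_univ, if_true]
  exact Finset.sum_eq_zero fun e _ => by
    rw [Fintype.sum_bool]; exact CharTwo.add_self_eq_zero _

theorem homologyClass_eq {a b : E → ZMod 2} (ha : a ∈ M.Cycles) (hb : b ∈ M.Cycles)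
    (h : a + b ∈ LinearMap.range M.boundaryTwo) : M.homologyClass a ha = M.homologyClass b hb := by
  refine (Submodule.Quotient.eq _).mpr ?_
  change a - b ∈ LinearMap.range M.boundaryTwo
  rwa [show a - b = a + b from funext fun e => CharTwo.sub_eq_add _ _]

theorem homologyClass_add {a b : E → ZMod 2} (ha : a ∈ M.Cycles) (hb : b ∈ M.Cycles) :
    M.homologyClass (a + b) (add_mem ha hb) = M.homologyClass a ha + M.homologyClass b hb := rfl

theorem homologyClass_smul (c : ZMod 2) {a : E → ZMod 2} (ha : a ∈ M.Cycles) :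
    M.homologyClass (c • a) (Submodule.smul_mem _ c ha) = c • M.homologyClass a ha := rfl

theorem homologyClass_congr {a b : E → ZMod 2} (ha : a ∈ M.Cycles) (h : a = b) :
    M.homologyClass a ha = M.homologyClass b (h ▸ ha) := by
  subst h; rfl

theorem homologyClass_eq_zero_iff {a : E → ZMod 2} (ha : a ∈ M.Cycles) :
    M.homologyClass a ha = 0 ↔ a ∈ LinearMap.range M.boundaryTwo :=
  Submodule.Quotient.mk_eq_zero _

/-! ### Sets of edges as chains -/

open scoped Classical in
theorem isEven_iff {A : Finset E} : M.IsEven A ↔ chain A ∈ M.Cycles := by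
  refine ⟨M.chain_mem_cycles, fun h v => ?_⟩
  have h' := congrFun (LinearMap.mem_ker.mp h) v
  rw [boundaryOne_apply] at h'
  simp only [chain, Pi.zero_apply] at h'
  rw [← Finset.sum_filter, Finset.filter_filter, Finset.sum_const, nsmul_one] at h'
  rw [ZMod.natCast_eq_zero_iff_even] at h'
  rw [Finset.filter_congr (fun d _ => and_comm)]
  convert h'

open scoped Classical in
/-- The set of edges with coefficient one in a chain. -/
def supp (a : E → ZMod 2) : Finset E := {e | a e = 1}

theorem zmod_two_cases (z : ZMod 2) : z = 0 ∨ z = 1 := by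
  revert z; decide

theorem chain_supp (a : E → ZMod 2) : chain (supp a) = a := by
  ext e
  rcases zmod_two_cases (a e) with h | h <;> simp [chain, supp, h]

theorem chain_eq_one_iff {F : Type*} {A : Finset F} {e : F} : chain A e = 1 ↔ e ∈ A := by
  classical
  simp [chain]

theorem supp_chain (A : Finset E) : supp (chain A) = A := by
  ext e
  simp [supp, chain_eq_one_iff]

/-- The cycles that are supported in a set of edges. -/
abbrev CyclesIn (G : Finset E) : Type _ := {a : E → ZMod 2 // a ∈ M.Cycles ∧ ∀ e ∉ G, a e = 0}

instance (G : Finset E) : Fintype (M.CyclesIn G) := Fintype.ofFinite _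

/-- The signed generating function of even sets as a sum over cycles. -/
theorem signedEvenSum_eq {S : Type*} [Ring S] (G : Finset E) (q : M.QuadForm) (w : Finset E → S) :
    M.signedEvenSum G q w =
      ∑ a : M.CyclesIn G, (-1) ^ (q.1 (M.homologyClass a.1 a.2.1)).val * w (supp a.1) := by
  classical
  unfold signedEvenSum
  refine Finset.sum_bij'
    (fun A _ => (⟨chain A.1, M.chain_mem_cycles A.2.2, fun e he => ?_⟩ : M.CyclesIn G))
    (fun a _ => ⟨supp a.1, fun e he => ?_, ?_⟩)
    (fun _ _ => Finset.mem_univ _) (fun _ _ => Finset.mem_univ _)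
    (fun A _ => Subtype.ext (supp_chain A.1))
    (fun a _ => Subtype.ext (chain_supp a.1)) fun A _ => ?_
  · simp only [chain, ite_eq_right_iff, one_ne_zero, imp_false]
    exact fun h => he (A.2.1 h)
  · by_contra h
    simp [supp, a.2.2 e h] at he
  · rw [isEven_iff, chain_supp]; exact a.2.1
  · simp only [evenClass, supp_chain]

end CellSurface

/-! ### The surface spanned by a set of edges -/

namespace CellSurface

variable {E : Type*} (M : CellSurface E)

/-- The first return is a positive power of `σ`, and no smaller positive power leads back. -/
theorem firstReturn_spec {α : Type*} [Finite α] (σ : Equiv.Perm α) (S : Set α) (x : S) :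
    ∃ n, 0 < n ∧ (σ ^ n) x.1 = (firstReturn σ S x).1 ∧ ∀ m, 0 < m → m < n → (σ ^ m) x.1 ∉ S := by
  classical
  have h : ∀ x : S, ∃ n : ℕ, 0 < n ∧ (σ ^ n) x.1 ∈ S := fun x =>
    ⟨orderOf σ, orderOf_pos σ, by rw [pow_orderOf_eq_one]; exact x.2⟩
  refine ⟨Nat.find (h x), (Nat.find_spec (h x)).1, rfl, fun m hm hlt hmem => ?_⟩
  exact Nat.find_min (h x) hlt ⟨hm, hmem⟩

/-- A dart of a set `P` of edges, as a dart of the whole 1-skeleton. -/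
def inclDart {P : Set E} (d : Dart P) : Dart E := (d.1.1, d.2)

theorem inclDart_flip {P : Set E} (d : Dart P) : inclDart d.flip = (inclDart d).flip := rfl

theorem inclDart_injective {P : Set E} : Function.Injective (inclDart : Dart P → Dart E) := by
  rintro ⟨⟨e, he⟩, b⟩ ⟨⟨e', he'⟩, b'⟩ h
  simp only [inclDart, Prod.mk.injEq] at h
  simp [h.1, h.2]

theorem exists_inclDart {P : Set E} {d : Dart E} (h : d.1 ∈ P) : ∃ d' : Dart P, inclDart d' = d :=
  ⟨(⟨d.1, h⟩, d.2), rfl⟩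

theorem extendChain_of_mem {P : Set E} (a : P → ZMod 2) {e : E} (h : e ∈ P) :
    extendChain a e = a ⟨e, h⟩ := dif_pos h

theorem extendChain_of_notMem {P : Set E} (a : P → ZMod 2) {e : E} (h : e ∉ P) :
    extendChain a e = 0 := dif_neg h

@[simp]
theorem extendChain_inclDart {P : Set E} (a : P → ZMod 2) (d : Dart P) :
    extendChain a (inclDart d).1 = a d.1 := extendChain_of_mem a d.1.2

theorem extendChain_add {P : Set E} (a b : P → ZMod 2) :
    extendChain (a + b) = extendChain a + extendChain b := by
  ext e
  by_cases h : e ∈ P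
  · simp [extendChain_of_mem _ h]
  · simp [extendChain_of_notMem _ h]

theorem extendChain_smul {P : Set E} (c : ZMod 2) (a : P → ZMod 2) :
    extendChain (c • a) = c • extendChain a := by
  ext e
  by_cases h : e ∈ P
  · simp [extendChain_of_mem _ h]
  · simp [extendChain_of_notMem _ h]

theorem extendToTarget_add {P : Set E} {k : ℕ} (a b : P → ZMod 2) :
    extendToTarget (k := k) (a + b) = extendToTarget a + extendToTarget b := by
  ext e
  cases e <;> simp [extendToTarget]

theorem extendToTarget_smul {P : Set E} {k : ℕ} (c : ZMod 2) (a : P → ZMod 2) :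
    extendToTarget (k := k) (c • a) = c • extendToTarget a := by
  ext e
  cases e <;> simp [extendToTarget]

section Restrict

variable [Finite E] {P : Set E}

/-- To pass from `rot d` to the rotation of `d` in the restricted surface, one turns past darts
outside `P`. -/
theorem restrict_rot_induction (motive : Dart E → Prop) (d : Dart P)
    (base : motive (M.rot (inclDart d)))
    (step : ∀ d', d'.1 ∉ P → motive d' → motive (M.rot d')) :
    motive (inclDart ((M.restrict P).rot d)) := by
  obtain ⟨n, hn, he, hout⟩ := firstReturn_spec M.rot {d : Dart E | d.1 ∈ P} (dartEquiv P d)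
  have h : inclDart ((M.restrict P).rot d) = (M.rot ^ n) (inclDart d) := he.symm
  rw [h]
  have key : ∀ m, 0 < m → m ≤ n → motive ((M.rot ^ m) (inclDart d)) := by
    intro m
    induction m with
    | zero => intro h; exact absurd h (lt_irrefl _)
    | succ m ih =>
      intro _ hle
      rcases Nat.eq_zero_or_pos m with rfl | hm
      · simpa using base
      · rw [pow_succ', Equiv.Perm.mul_apply]
        exact step _ (hout m hm (by omega)) (ih hm (by omega))
  exact key n hn le_rfl

theorem restrict_rot_of_mem (d : Dart P) (h : (M.rot (inclDart d)).1 ∈ P) :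
    inclDart ((M.restrict P).rot d) = M.rot (inclDart d) := by
  obtain ⟨n, hn, he, hout⟩ := firstReturn_spec M.rot {d : Dart E | d.1 ∈ P} (dartEquiv P d)
  have h' : inclDart ((M.restrict P).rot d) = (M.rot ^ n) (inclDart d) := he.symm
  rcases Nat.lt_or_ge 1 n with h1 | h1
  · exact absurd h (hout 1 one_pos h1)
  · obtain rfl : n = 1 := by omega
    simpa using h'

theorem tail_inclDart_restrict_rot (d : Dart P) :
    M.tail (inclDart ((M.restrict P).rot d)) = M.tail (inclDart d) :=
  M.restrict_rot_induction (fun d' => M.tail d' = M.tail (inclDart d)) d (M.tail_rot _)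
    fun d' _ h => (M.tail_rot d').trans h

/-- A potential does not change at the darts that are erased. -/
theorem isPotential_restrict {a : P → ZMod 2} {p : Dart E → ZMod 2}
    (hp : M.IsPotential (extendChain a) p) :
    (M.restrict P).IsPotential a (fun d => p (inclDart d)) := by
  intro d
  refine M.restrict_rot_induction (fun d' => p d' = p (inclDart d) + a d.1) d ?_ ?_
  · rw [hp, extendChain_inclDart]
  · intro d' hd' h
    rw [hp, extendChain_of_notMem _ hd', add_zero, h]

end Restrict

variable [Fintype E] {P : Set E}

theorem sum_dart_extend [Fintype P] (f : Dart E → ZMod 2)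
    (hf : ∀ d, d.1 ∉ P → f d = 0) : ∑ d, f d = ∑ d : Dart P, f (inclDart d) := by
  symm
  refine Finset.sum_of_injOn inclDart (inclDart_injective.injOn) (by simp) ?_ (fun _ _ => rfl)
  intro d _ hd
  refine hf d fun hP => hd ?_
  obtain ⟨d', rfl⟩ := exists_inclDart hP
  exact ⟨d', by simp, rfl⟩

theorem extendChain_mem_cycles {a : P → ZMod 2} {p : Dart P → ZMod 2}
    (hp : (M.restrict P).IsPotential a p) : extendChain a ∈ M.Cycles := by
  classical
  have : Fintype P := Fintype.ofFinite P
  rw [← boundaryOne_eq_zero_iff]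
  ext v
  rw [boundaryOne_apply, Finset.sum_filter,
    sum_dart_extend (P := P) _ fun d hd => by simp [extendChain_of_notMem a hd]]
  simp_rw [extendChain_inclDart]
  have h : ∀ d, a d.1 = p ((M.restrict P).rot d) - p d := fun d => by rw [hp d]; ring
  have h' : ∀ d : Dart P, (if M.tail (inclDart d) = v then a d.1 else 0)
      = (if M.tail (inclDart ((M.restrict P).rot d)) = v then p ((M.restrict P).rot d) else 0)
        - if M.tail (inclDart d) = v then p d else 0 := by
    intro d
    rw [tail_inclDart_restrict_rot, h d]
    split_ifs <;> simp
  simp_rw [h', Finset.sum_sub_distrib]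
  rw [Equiv.sum_comp (M.restrict P).rot
    (fun d => if M.tail (inclDart d) = v then p d else 0), sub_self]
  rfl

/-! ### Drawing the target into a face -/

/-- The product of disjoint transpositions interchanges `a i` and `b i` for all `i`. -/
theorem prod_swap_apply {α ι : Type*} [DecidableEq α] {a b : ι → α} (ha : a.Injective)
    (hb : b.Injective) (hab : ∀ i j, a i ≠ b j) (l : List ι) (hl : l.Nodup) :
    (∀ i ∈ l, ((l.map fun j => Equiv.swap (a j) (b j)).prod) (a i) = b i) ∧
    (∀ i ∈ l, ((l.map fun j => Equiv.swap (a j) (b j)).prod) (b i) = a i) ∧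
    ∀ x, (∀ i ∈ l, x ≠ a i ∧ x ≠ b i) →
      ((l.map fun j => Equiv.swap (a j) (b j)).prod) x = x := by
  induction l with
  | nil => simp
  | cons j l ih =>
    obtain ⟨h1, h2, h3⟩ := ih (List.nodup_cons.mp hl).2
    have hj : j ∉ l := (List.nodup_cons.mp hl).1
    simp only [List.map_cons, List.prod_cons, Equiv.Perm.mul_apply]
    have hne : ∀ i ∈ l, i ≠ j := fun i hi h => hj (h ▸ hi)
    refine ⟨fun i hi => ?_, fun i hi => ?_, fun x hx => ?_⟩
    · rcases List.mem_cons.mp hi with rfl | hi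
      · rw [h3 _ fun i' hi' => ⟨fun h => hne i' hi' (ha h.symm), hab _ _⟩, Equiv.swap_apply_left]
      · rw [h1 i hi, Equiv.swap_apply_of_ne_of_ne (hab _ _).symm
          fun h => hne i hi (hb h)]
    · rcases List.mem_cons.mp hi with rfl | hi
      · rw [h3 _ fun i' hi' => ⟨(hab _ _).symm, fun h => hne i' hi' (hb h.symm)⟩,
          Equiv.swap_apply_right]
      · rw [h2 i hi, Equiv.swap_apply_of_ne_of_ne (fun h => hne i hi (ha h)) (hab _ _)]
    · rw [h3 x fun i hi => hx i (List.mem_cons_of_mem _ hi),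
        Equiv.swap_apply_of_ne_of_ne (hx j List.mem_cons_self).1 (hx j List.mem_cons_self).2]

section Attach

variable {F : Type*} (Q : CellSurface F) {k : ℕ} {corner : Fin k → Dart F}
  (r : Equiv.Perm (Fin k))

/-- A dart of the surface, as a dart of the surface with the target. -/
def inlDart (d : Dart F) : Dart (F ⊕ TargetEdge k) := (Sum.inl d.1, d.2)

theorem sumRot_inl {G : Type*} (σ : Equiv.Perm (Dart F)) (τ : Equiv.Perm (Dart G)) (d : Dart F) :
    sumRot σ τ (Sum.inl d.1, d.2) = (Sum.inl (σ d).1, (σ d).2) := rfl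

theorem sumRot_inr {G : Type*} (σ : Equiv.Perm (Dart F)) (τ : Equiv.Perm (Dart G)) (d : Dart G) :
    sumRot σ τ (Sum.inr d.1, d.2) = (Sum.inr (τ d).1, (τ d).2) := rfl

theorem inlDart_injective : Function.Injective (inlDart : Dart F → Dart (F ⊕ TargetEdge k)) := by
  rintro ⟨e, b⟩ ⟨e', b'⟩ h
  simpa [inlDart] using h

theorem attachTarget_rot_aux (hc : corner.Injective) :
    (∀ j, (Q.attachTarget corner r).rot (inlDart (corner j)) = (Sum.inr (Sum.inr j), false)) ∧
    (∀ j, (Q.attachTarget corner r).rot (Sum.inr (Sum.inr j), false)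
      = inlDart (Q.rot (corner j))) ∧
    ∀ x, (∀ j, x ≠ inlDart (corner j) ∧ x ≠ (Sum.inr (Sum.inr j), false)) →
      (Q.attachTarget corner r).rot x = sumRot Q.rot (targetRot r) x := by
  classical
  obtain ⟨h1, h2, h3⟩ := prod_swap_apply (α := Dart (F ⊕ TargetEdge k))
    (a := fun j : Fin k => inlDart (corner j))
    (b := fun j : Fin k => (Sum.inr (Sum.inr j), false))
    (inlDart_injective.comp hc) (fun i j h => by simpa using h)
    (fun i j h => by simp [inlDart] at h) (List.finRange k) (List.nodup_finRange k)
  refine ⟨fun j => ?_, fun j => ?_, fun x hx => ?_⟩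
  · have := h1 j (List.mem_finRange j)
    simp only [attachTarget, Equiv.Perm.mul_apply, List.ofFn_eq_map]
    refine (congrArg (sumRot Q.rot (targetRot r)) (Eq.trans ?_ this)).trans
      (sumRot_inr Q.rot (targetRot r) (Sum.inr j, false))
    congr
  · have := h2 j (List.mem_finRange j)
    simp only [attachTarget, Equiv.Perm.mul_apply, List.ofFn_eq_map]
    refine (congrArg (sumRot Q.rot (targetRot r)) (Eq.trans ?_ this)).trans
      (sumRot_inl Q.rot (targetRot r) (corner j))
    congr
  · have := h3 x fun j _ => hx j
    simp only [attachTarget, Equiv.Perm.mul_apply, List.ofFn_eq_map]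
    refine congrArg (sumRot Q.rot (targetRot r)) (Eq.trans ?_ this)
    congr

theorem attachTarget_rot_corner (hc : corner.Injective) (j : Fin k) :
    (Q.attachTarget corner r).rot (inlDart (corner j)) = (Sum.inr (Sum.inr j), false) :=
  (Q.attachTarget_rot_aux r hc).1 j

theorem attachTarget_rot_end (hc : corner.Injective) (j : Fin k) :
    (Q.attachTarget corner r).rot (Sum.inr (Sum.inr j), false) = inlDart (Q.rot (corner j)) :=
  (Q.attachTarget_rot_aux r hc).2.1 j

theorem attachTarget_rot_inl (hc : corner.Injective) {d : Dart F} (hd : d ∉ Set.range corner) :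
    (Q.attachTarget corner r).rot (inlDart d) = inlDart (Q.rot d) :=
  (Q.attachTarget_rot_aux r hc).2.2 _ fun j =>
    ⟨fun h => hd ⟨j, (inlDart_injective h).symm⟩, fun h => by simp [inlDart] at h⟩

theorem attachTarget_rot_centre (hc : corner.Injective) (j : Fin k) :
    (Q.attachTarget corner r).rot (Sum.inr (Sum.inl j), true) = (Sum.inr (Sum.inl (r j)), true) :=
  (Q.attachTarget_rot_aux r hc).2.2 _ fun i => ⟨fun h => by simp [inlDart] at h, by simp⟩

theorem attachTarget_rot_inner (hc : corner.Injective) (j : Fin k) :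
    (Q.attachTarget corner r).rot (Sum.inr (Sum.inl j), false) = (Sum.inr (Sum.inr j), true) :=
  (Q.attachTarget_rot_aux r hc).2.2 _ fun i => ⟨fun h => by simp [inlDart] at h, by simp⟩

theorem attachTarget_rot_outer (hc : corner.Injective) (j : Fin k) :
    (Q.attachTarget corner r).rot (Sum.inr (Sum.inr j), true) = (Sum.inr (Sum.inl j), false) :=
  (Q.attachTarget_rot_aux r hc).2.2 _ fun i => ⟨fun h => by simp [inlDart] at h, by simp⟩

/-- The kinds of darts on which the rotation of the surface with the target is given by different
formulas. -/
theorem attachTarget_dart_cases {motive : Dart (F ⊕ TargetEdge k) → Prop}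
    (corner : Fin k → Dart F)
    (inl : ∀ d, d ∉ Set.range corner → motive (inlDart d))
    (hcorner : ∀ j, motive (inlDart (corner j)))
    (centre : ∀ j, motive (Sum.inr (Sum.inl j), true))
    (inner : ∀ j, motive (Sum.inr (Sum.inl j), false))
    (outer : ∀ j, motive (Sum.inr (Sum.inr j), true))
    (ending : ∀ j, motive (Sum.inr (Sum.inr j), false)) (d) : motive d := by
  obtain ⟨e | i | i, _ | _⟩ := d
  case inl.false =>
    by_cases h : ((e, false) : Dart F) ∈ Set.range corner
    · obtain ⟨j, hj⟩ := h
      have hm := hcorner j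
      rwa [hj] at hm
    · exact inl _ h
  case inl.true =>
    by_cases h : ((e, true) : Dart F) ∈ Set.range corner
    · obtain ⟨j, hj⟩ := h
      have hm := hcorner j
      rwa [hj] at hm
    · exact inl _ h
  · exact inner i
  · exact centre i
  · exact ending i
  · exact outer i

end Attach

/-! ### Cycles and boundaries in the presence of the target -/

section Attach

variable {F : Type*} (Q : CellSurface F) {k : ℕ} {corner : Fin k → Dart F}
  (r : Equiv.Perm (Fin k))

/-- The extension to the target of a function on darts. Its values on the `j`-th leg are: `centre j`
and `inner j` on the darts of the inner edge that start at the centre and at the middle vertex,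
`outer j` and `ending j` on those of the outer edge that start at the middle vertex and at the end
vertex. -/
def attachFun (p : Dart F → ZMod 2) (centre inner outer ending : Fin k → ZMod 2) :
    Dart (F ⊕ TargetEdge k) → ZMod 2
  | (Sum.inl e, b) => p (e, b)
  | (Sum.inr (Sum.inl j), true) => centre j
  | (Sum.inr (Sum.inl j), false) => inner j
  | (Sum.inr (Sum.inr j), true) => outer j
  | (Sum.inr (Sum.inr j), false) => ending j

theorem isPotential_attachTarget (hc : corner.Injective) {a : F → ZMod 2} {p : Dart F → ZMod 2}
    (hp : Q.IsPotential a p) :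
    (Q.attachTarget corner r).IsPotential (Sum.elim a fun _ => 0)
      (attachFun p 0 0 0 fun j => p (Q.rot (corner j))) := by
  refine attachTarget_dart_cases corner (fun d hd => ?_) (fun j => ?_) (fun j => ?_) (fun j => ?_)
    (fun j => ?_) (fun j => ?_)
  · rw [Q.attachTarget_rot_inl r hc hd]
    exact hp d
  · rw [Q.attachTarget_rot_corner r hc]
    exact hp (corner j)
  · rw [Q.attachTarget_rot_centre r hc]
    simp [attachFun]
  · rw [Q.attachTarget_rot_inner r hc]
    simp [attachFun]
  · rw [Q.attachTarget_rot_outer r hc]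
    simp [attachFun]
  · rw [Q.attachTarget_rot_end r hc]
    exact (add_zero _).symm

theorem isPotential_of_attachTarget (hc : corner.Injective) {a : F → ZMod 2}
    {p : Dart (F ⊕ TargetEdge k) → ZMod 2}
    (hp : (Q.attachTarget corner r).IsPotential (Sum.elim a fun _ => 0) p) :
    Q.IsPotential a (fun d => p (inlDart d)) := by
  intro d
  by_cases hd : d ∈ Set.range corner
  · obtain ⟨j, rfl⟩ := hd
    have h1 := hp (inlDart (corner j))
    have h2 := hp (Sum.inr (Sum.inr j), false)
    rw [Q.attachTarget_rot_corner r hc] at h1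
    rw [Q.attachTarget_rot_end r hc] at h2
    exact (h2.trans (add_zero _)).trans h1
  · have h := hp (inlDart d)
    rwa [Q.attachTarget_rot_inl r hc hd] at h

/-- A cycle contains both edges of a leg or none of them. -/
theorem cycle_inner_eq_outer [Fintype F] (hc : corner.Injective)
    {c : F ⊕ TargetEdge k → ZMod 2} (h : c ∈ (Q.attachTarget corner r).Cycles) (j : Fin k) :
    c (Sum.inr (Sum.inl j)) = c (Sum.inr (Sum.inr j)) := by
  obtain ⟨p, hp⟩ := exists_isPotential _ _ h
  have h1 := hp (Sum.inr (Sum.inl j), false)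
  have h2 := hp (Sum.inr (Sum.inr j), true)
  rw [Q.attachTarget_rot_inner r hc] at h1
  rw [Q.attachTarget_rot_outer r hc, h1] at h2
  linear_combination (-1 : ZMod 2) * h2 - CharTwo.add_self_eq_zero (c (Sum.inr (Sum.inr j)))

/-- A cycle contains an even number of legs. -/
theorem cycle_sum_legs [Fintype F] (hc : corner.Injective)
    {c : F ⊕ TargetEdge k → ZMod 2} (h : c ∈ (Q.attachTarget corner r).Cycles) :
    ∑ j, c (Sum.inr (Sum.inr j)) = 0 := by
  obtain ⟨p, hp⟩ := exists_isPotential _ _ h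
  have h1 : ∀ j, c (Sum.inr (Sum.inr j))
      = p (Sum.inr (Sum.inl (r j)), true) - p (Sum.inr (Sum.inl j), true) := by
    intro j
    have h1 := hp (Sum.inr (Sum.inl j), true)
    rw [Q.attachTarget_rot_centre r hc] at h1
    rw [h1, ← Q.cycle_inner_eq_outer r hc h]
    ring
  simp_rw [h1, Finset.sum_sub_distrib]
  rw [Equiv.sum_comp r (fun j => p (Sum.inr (Sum.inl j), true)), sub_self]

/-- A function on the darts of the surface which is constant along faces, except that it may jump
at the corners where legs arrive, has as boundary a chain that runs through those legs at which
it jumps: the target cuts the disc into sectors, and the function takes the values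
`g (corner j)` and `g (Q.rot (corner j)).flip` on the two sides of the `j`-th leg. -/
theorem sum_elim_mem_range_boundaryTwo [Fintype F] (hc : corner.Injective)
    (g : Dart F → ZMod 2) (hg : ∀ d ∉ Set.range corner, g (Q.rot d).flip = g d)
    (hr : ∀ j, g (Q.rot (corner (r j))).flip = g (corner j)) :
    Sum.elim (dartBoundary g)
        (Sum.elim (fun j => g (corner j) + g (Q.rot (corner j)).flip)
          fun j => g (corner j) + g (Q.rot (corner j)).flip)
      ∈ LinearMap.range (Q.attachTarget corner r).boundaryTwo := by
  rw [mem_range_boundaryTwo_iff]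
  refine ⟨attachFun g (fun j => g (corner j)) (fun j => g (Q.rot (corner j)).flip)
    (fun j => g (corner j)) (fun j => g (Q.rot (corner j)).flip), ?_, ?_⟩
  · refine attachTarget_dart_cases corner (fun d hd => ?_) (fun j => ?_) (fun j => ?_)
      (fun j => ?_) (fun j => ?_) (fun j => ?_)
    · rw [Q.attachTarget_rot_inl r hc hd]
      exact hg d hd
    · rw [Q.attachTarget_rot_corner r hc]
      rfl
    · rw [Q.attachTarget_rot_centre r hc]
      exact hr j
    · rw [Q.attachTarget_rot_inner r hc]
      rfl
    · rw [Q.attachTarget_rot_outer r hc]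
      rfl
    · rw [Q.attachTarget_rot_end r hc]
      rfl
  · ext e
    obtain e | i | i := e <;> rfl

/-- A boundary that contains no edge of the target bounds after the target has been erased. -/
theorem mem_range_boundaryTwo_of_attachTarget [Fintype F] (hc : corner.Injective)
    {a : F → ZMod 2}
    (h : Sum.elim a (fun _ => 0) ∈ LinearMap.range (Q.attachTarget corner r).boundaryTwo) :
    a ∈ LinearMap.range Q.boundaryTwo := by
  rw [mem_range_boundaryTwo_iff] at h ⊢
  obtain ⟨g, hg, hga⟩ := h
  refine ⟨fun d => g (inlDart d), fun d => ?_, ?_⟩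
  · by_cases hd : d ∈ Set.range corner
    · obtain ⟨j, rfl⟩ := hd
      have h1 := hg (inlDart (corner j))
      have h2 := hg (Sum.inr (Sum.inr j), false)
      have h3 := congrFun hga (Sum.inr (Sum.inr j))
      rw [Q.attachTarget_rot_corner r hc] at h1
      rw [Q.attachTarget_rot_end r hc] at h2
      simp only [dartBoundary, Sum.elim_inr, CharTwo.add_eq_zero] at h3
      exact h2.trans (h3.symm.trans h1)
    · have h := hg (inlDart d)
      rw [Q.attachTarget_rot_inl r hc hd] at h
      exact h
  · ext e
    exact congrFun hga (Sum.inl e)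

end Attach

section RestrictAttach

variable {E : Type*} [Fintype E] (M : CellSurface E) {P : Set E} {k : ℕ}
  {corner : Fin k → Dart P} (r : Equiv.Perm (Fin k))

/-- Neither erasing edges nor drawing the target affects which chains off the target are cycles. -/
theorem extendToTarget_mem_cycles_iff [Fintype P] (hc : corner.Injective) {a : P → ZMod 2} :
    extendToTarget a ∈ ((M.restrict P).attachTarget corner r).Cycles ↔
      extendChain a ∈ M.Cycles := by
  constructor
  · intro h
    obtain ⟨p, hp⟩ := exists_isPotential _ _ h
    exact M.extendChain_mem_cycles ((M.restrict P).isPotential_of_attachTarget r hc hp)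
  · intro h
    obtain ⟨p, hp⟩ := exists_isPotential _ _ h
    exact mem_cycles_of_isPotential _
      ((M.restrict P).isPotential_attachTarget r hc (M.isPotential_restrict hp))

/-- Cycles off the target have the same intersection number in both surfaces. -/
theorem intersectionForm_extendToTarget [Fintype P] (hc : corner.Injective) {a b : P → ZMod 2}
    (ha : extendChain a ∈ M.Cycles) (hb : extendChain b ∈ M.Cycles)
    (ha' : extendToTarget a ∈ ((M.restrict P).attachTarget corner r).Cycles)
    (hb' : extendToTarget b ∈ ((M.restrict P).attachTarget corner r).Cycles) :
    ((M.restrict P).attachTarget corner r).intersectionForm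
        (homologyClass _ _ ha') (homologyClass _ _ hb')
      = M.intersectionForm (M.homologyClass _ ha) (M.homologyClass _ hb) := by
  obtain ⟨p, hp⟩ := exists_isPotential _ _ ha
  have hp' := (M.restrict P).isPotential_attachTarget r hc (M.isPotential_restrict hp)
  rw [M.intersectionForm_homologyClass ⟨_, ha⟩ ⟨_, hb⟩ p hp,
    intersectionForm_homologyClass _ ⟨_, ha'⟩ ⟨_, hb'⟩ _ hp']
  simp only [crossing, Fintype.sum_sum_type]
  simp only [extendToTarget, Sum.elim_inr, mul_zero, Finset.sum_const_zero, add_zero]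
  refine Finset.sum_of_injOn Subtype.val Subtype.val_injective.injOn (by simp) ?_ ?_
  · intro e _ he
    rw [extendChain_of_notMem b fun hP => he ⟨⟨e, hP⟩, by simp, rfl⟩, mul_zero]
  · intro e _
    rw [extendChain_of_mem b e.2, extendChain_of_mem a e.2]
    rfl

end RestrictAttach

/-! ### Restricting quadratic forms -/

/-- A quadratic form `q` descends along a surjective linear map `ψ` to exactly one function if
`q ∘ φ` vanishes on `ker ψ` and `φ`, `ψ` carry the two bilinear forms to the same form. -/
theorem existsUnique_quadratic {Z V W : Type*} [AddCommGroup Z] [AddCommGroup V] [AddCommGroup W]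
    [Module (ZMod 2) Z] [Module (ZMod 2) V] [Module (ZMod 2) W]
    (B : V →ₗ[ZMod 2] V →ₗ[ZMod 2] ZMod 2) (B' : W →ₗ[ZMod 2] W →ₗ[ZMod 2] ZMod 2)
    (φ : Z →ₗ[ZMod 2] V) (ψ : Z →ₗ[ZMod 2] W) (hψ : Function.Surjective ψ)
    (hker : ∀ z, ψ z = 0 → φ z = 0) (hB : ∀ y z, B' (ψ y) (ψ z) = B (φ y) (φ z))
    (q : {q : V → ZMod 2 // ∀ x y, q (x + y) = q x + q y + B x y}) :
    ∃! q' : {q : W → ZMod 2 // ∀ x y, q (x + y) = q x + q y + B' x y},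
      ∀ z, q'.1 (ψ z) = q.1 (φ z) := by
  obtain ⟨s, hs⟩ := hψ.hasRightInverse
  have hφ : ∀ y z, ψ y = ψ z → φ y = φ z := fun y z h => by
    rw [← sub_eq_zero, ← map_sub]
    exact hker _ (by rw [map_sub, h, sub_self])
  refine ⟨⟨fun w => q.1 (φ (s w)), fun x y => ?_⟩, fun z => ?_, fun q' hq' => ?_⟩
  · change q.1 (φ (s (x + y))) = q.1 (φ (s x)) + q.1 (φ (s y)) + B' x y
    rw [hφ (s (x + y)) (s x + s y) (by rw [map_add, hs, hs, hs]), map_add, q.2, ← hB, hs, hs]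
  · exact congrArg q.1 (hφ _ _ (hs _))
  · refine Subtype.ext (funext fun w => ?_)
    rw [← hq', hs]

section Restriction

variable {E : Type*} [Fintype E] (M : CellSurface E) {P : Set E} {k : ℕ}
  {corner : Fin k → Dart P} (r : Equiv.Perm (Fin k))

/-- The cycles of the 1-skeleton with edges in `P`. -/
def CyclesOn (P : Set E) : Submodule (ZMod 2) (P → ZMod 2) where
  carrier := {a | extendChain a ∈ M.Cycles}
  add_mem' {a b} ha hb := by
    rw [Set.mem_ofPred_eq, extendChain_add]; exact add_mem ha hb
  zero_mem' := by
    rw [Set.mem_ofPred_eq, ← zero_smul (ZMod 2) 0, extendChain_smul, zero_smul]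
    exact zero_mem _
  smul_mem' c a ha := by
    rw [Set.mem_ofPred_eq, extendChain_smul]; exact Submodule.smul_mem _ c ha

/-- The homology class in `M` of a cycle with edges in `P`. -/
def classOn (P : Set E) : M.CyclesOn P →ₗ[ZMod 2] M.H1 where
  toFun a := M.homologyClass (extendChain a.1) a.2
  map_add' a b := (M.homologyClass_congr _ (extendChain_add _ _)).trans
    (M.homologyClass_add a.2 b.2)
  map_smul' c a := (M.homologyClass_congr _ (extendChain_smul _ _)).trans
    (M.homologyClass_smul c a.2)

/-- The homology class of a cycle with edges in `P`, in a surface `N` in which these are the edges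
outside of the target. -/
def targetClassOn [Fintype P] {k : ℕ} (N : CellSurface (P ⊕ TargetEdge k))
    (Z : Submodule (ZMod 2) (P → ZMod 2)) (hZ : ∀ a : Z, extendToTarget a.1 ∈ N.Cycles) :
    Z →ₗ[ZMod 2] N.H1 where
  toFun a := N.homologyClass (extendToTarget a.1) (hZ a)
  map_add' a b := (N.homologyClass_congr _ (extendToTarget_add _ _)).trans
    (N.homologyClass_add (hZ a) (hZ b))
  map_smul' c a := (N.homologyClass_congr _ (extendToTarget_smul _ _)).trans
    (N.homologyClass_smul c (hZ a))

open scoped Classical in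
/-- A quadratic form has exactly one restriction to the surface with the target, provided that
every cycle can be pushed out of the target, and every cycle outside of the target that bounds in
the new surface bounds in the old one. -/
theorem existsUnique_isRestriction (hc : corner.Injective)
    (hsurj : ∀ c : P ⊕ TargetEdge k → ZMod 2,
      c ∈ ((M.restrict P).attachTarget corner r).Cycles → ∃ a : P → ZMod 2,
      c + extendToTarget a ∈ LinearMap.range ((M.restrict P).attachTarget corner r).boundaryTwo)
    (hinj : ∀ a : P → ZMod 2, a ∈ LinearMap.range (M.restrict P).boundaryTwo →
      extendChain a ∈ LinearMap.range M.boundaryTwo)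
    (q : M.QuadForm) :
    ∃! q' : ((M.restrict P).attachTarget corner r).QuadForm,
      IsRestriction q ((M.restrict P).attachTarget corner r) q' := by
  have hZ : ∀ a : M.CyclesOn P, extendToTarget a.1 ∈
      LinearMap.ker ((M.restrict P).attachTarget corner r).boundaryOne := fun a =>
    (M.extendToTarget_mem_cycles_iff r hc).mpr a.2
  have h1 : Function.Surjective (targetClassOn _ _ hZ) := by
    intro w
    obtain ⟨⟨c, hcyc⟩, rfl⟩ := Submodule.Quotient.mk_surjective _ w
    obtain ⟨a, ha⟩ := hsurj c hcyc
    have ha' : extendToTarget a ∈ ((M.restrict P).attachTarget corner r).Cycles := by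
      obtain ⟨f, hf⟩ := ha
      have h1 := add_mem hcyc (boundaryTwo_mem_cycles _ f)
      rwa [hf, ← add_assoc, show c + c = 0 from funext fun e => CharTwo.add_self_eq_zero _,
        zero_add] at h1
    refine ⟨⟨a, (M.extendToTarget_mem_cycles_iff r hc).mp ha'⟩, ?_⟩
    exact (homologyClass_eq _ hcyc ha' ha).symm
  have h2 : ∀ z, targetClassOn _ _ hZ z = 0 → M.classOn P z = 0 := by
    intro z hz
    exact (M.homologyClass_eq_zero_iff z.2).mpr
      (hinj _ ((M.restrict P).mem_range_boundaryTwo_of_attachTarget r hc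
        ((homologyClass_eq_zero_iff _ (hZ z)).mp hz)))
  have h3 : ∀ y z, ((M.restrict P).attachTarget corner r).intersectionForm
      (targetClassOn _ _ hZ y) (targetClassOn _ _ hZ z)
        = M.intersectionForm (M.classOn P y) (M.classOn P z) := fun y z =>
    M.intersectionForm_extendToTarget r hc y.2 z.2 (hZ y) (hZ z)
  have h := existsUnique_quadratic M.intersectionForm
    ((M.restrict P).attachTarget corner r).intersectionForm (M.classOn P)
    (targetClassOn _ _ hZ) h1 h2 h3 q
  refine (existsUnique_congr fun q' => ?_).mp h
  exact ⟨fun h a ha ha' => h ⟨a, ha⟩, fun h z => h z.1 z.2 (hZ z)⟩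

end Restriction

/-! ### The boundary of a region -/

section Region

variable {E : Type*} (M : CellSurface E) {S : Set M.Face}

theorem mem_closedEdges_iff {d : Dart E} :
    d.1 ∈ M.closedEdges S ↔ M.leftFace d ∈ S ∨ M.leftFace d.flip ∈ S := by
  obtain ⟨e, b⟩ := d
  cases b
  · exact Or.comm
  · exact Iff.rfl

variable [Finite E]

theorem leftFace_restrict_flip_rot {d : Dart (M.closedEdges S)}
    (h : M.leftFace (inclDart d) ∈ S) :
    inclDart ((M.restrict (M.closedEdges S)).rot d).flip = (M.rot (inclDart d)).flip := by
  rw [inclDart_flip, restrict_rot_of_mem]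
  rw [mem_closedEdges_iff, M.leftFace_flip_rot]
  exact Or.inr h

/-- Turning counterclockwise from a dart on whose left hand side the complement of the region lies,
one stays in the complement up to the next dart of the closure of the region. -/
theorem leftFace_restrict_flip_rot_notMem {d : Dart (M.closedEdges S)}
    (h : M.leftFace (inclDart d) ∉ S) :
    M.leftFace (inclDart ((M.restrict (M.closedEdges S)).rot d)).flip ∉ S := by
  refine M.restrict_rot_induction (fun d' => M.leftFace d'.flip ∉ S) d ?_ ?_
  · rwa [leftFace_flip_rot]
  · intro d' hd' _
    rw [leftFace_flip_rot]
    exact fun h => hd' (M.mem_closedEdges_iff.mpr (Or.inl h))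

end Region

namespace SeparatingCurve

variable {E : Type*} {M : CellSurface E} (C : M.SeparatingCurve)

instance neZero_length : NeZero C.length := C.length_pos

theorem leftFace_dart (i : Fin C.length) : M.leftFace (C.dart i) ∈ C.left :=
  ((C.mem_range_dart_iff _).mp ⟨i, rfl⟩).1

theorem leftFace_dart_flip (i : Fin C.length) : M.leftFace (C.dart i).flip ∉ C.left :=
  ((C.mem_range_dart_iff _).mp ⟨i, rfl⟩).2

theorem dart_fst_injective : Function.Injective fun i => (C.dart i).1 := by
  intro i j h
  rcases Dart.eq_or_eq_flip h with h | h
  · exact C.simple (congrArg M.tail h)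
  · have h1 := C.leftFace_dart i
    rw [h] at h1
    exact absurd h1 (C.leftFace_dart_flip j)

theorem tail_dart_flip (i : Fin C.length) : M.tail (C.dart i).flip = M.tail (C.dart (i + 1)) :=
  (C.closed i).symm

open scoped Classical in
/-- The chain that contains the `i`-th edge of the curve with coefficient `h i`. -/
def curveChain (h : Fin C.length → ZMod 2) : E → ZMod 2 :=
  fun e => ∑ i, if (C.dart i).1 = e then h i else 0

theorem curveChain_of_notMem (h : Fin C.length → ZMod 2) {e : E}
    (he : ∀ i, (C.dart i).1 ≠ e) : C.curveChain h e = 0 := by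
  classical
  exact Finset.sum_eq_zero fun i _ => if_neg (he i)

/-- The closure of the region `S` on one side of the curve, capped off by a disc: the darts
with the disc to their left are the darts `ext i` on the edges of the curve, and `ext (s i)` precedes
`ext i` on the boundary walk of the disc. The last condition says that this walk passes through all
of them, that is, that the disc is a single face. -/
structure IsCap [Finite E] (S : Set M.Face) (ext : Fin C.length → Dart (M.closedEdges S))
    (s : Fin C.length → Fin C.length) : Prop where
  edge : ∀ i, (ext i).1.1 = (C.dart i).1
  mem_range : ∀ d, d ∈ Set.range ext ↔ M.leftFace (inclDart d) ∉ S
  flip_rot : ∀ i, ((M.restrict (M.closedEdges S)).rot (ext i)).flip = ext (s i)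
  eq_of_invariant : ∀ h : Fin C.length → ZMod 2, (∀ i, h (s i) = h i) → ∀ i j, h i = h j

namespace IsCap

variable {C} [Fintype E] {S : Set M.Face} {ext : Fin C.length → Dart (M.closedEdges S)}
  {s : Fin C.length → Fin C.length}

theorem ext_injective (hcap : C.IsCap S ext s) : Function.Injective ext := fun i j h =>
  C.dart_fst_injective (by
    change (C.dart i).1 = (C.dart j).1
    rw [← hcap.edge, ← hcap.edge, h])

/-- A chain that bounds in the capped surface bounds in the whole surface: as the capping disc is
a single face, the 2-chain can be chosen to vanish there, and then be extended by zero. -/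
theorem extendChain_mem_range (hcap : C.IsCap S ext s) [Fintype (M.closedEdges S)]
    {a : M.closedEdges S → ZMod 2}
    (ha : a ∈ LinearMap.range (M.restrict (M.closedEdges S)).boundaryTwo) :
    extendChain a ∈ LinearMap.range M.boundaryTwo := by
  classical
  rw [mem_range_boundaryTwo_iff] at ha ⊢
  obtain ⟨g, hg, rfl⟩ := ha
  set c := g (ext 0) with hcdef
  have hc : ∀ d, M.leftFace (inclDart d) ∉ S → g d = c := by
    intro d hd
    obtain ⟨i, rfl⟩ := (hcap.mem_range d).mpr hd
    exact hcap.eq_of_invariant (fun i => g (ext i))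
      (fun i => by rw [← hcap.flip_rot, hg]) i 0
  -- `g + c` vanishes on the disc.
  let g' : Dart E → ZMod 2 := fun d =>
    if h : M.leftFace d ∈ S then g (⟨d.1, M.mem_closedEdges_iff.mpr (Or.inl h)⟩, d.2) + c else 0
  have h0 : ∀ d, M.leftFace d ∉ S → g' d = 0 := fun d hd => dif_neg hd
  have h1 : ∀ d : Dart (M.closedEdges S), g' (inclDart d) = g d + c := by
    intro d
    by_cases hd : M.leftFace (inclDart d) ∈ S
    · exact dif_pos hd
    · rw [h0 _ hd, hc d hd, CharTwo.add_self_eq_zero]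
  refine ⟨g', fun d => ?_, funext fun e => ?_⟩
  · by_cases hd : M.leftFace d ∈ S
    · obtain ⟨d, rfl⟩ := exists_inclDart (M.mem_closedEdges_iff.mpr (Or.inl hd))
      rw [← M.leftFace_restrict_flip_rot hd, h1, h1, hg]
    · rw [h0 d hd, h0 _ (by rwa [M.leftFace_flip_rot])]
  · by_cases he : e ∈ M.closedEdges S
    · rw [extendChain_of_mem _ he]
      change g' (inclDart (⟨e, he⟩, true)) + g' (inclDart (⟨e, he⟩, false)) = _ + _
      rw [h1, h1, add_add_add_comm, CharTwo.add_self_eq_zero, add_zero]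
    · rw [extendChain_of_notMem _ he]
      change g' _ + g' _ = 0
      rw [h0 _ fun h => he (Or.inl h), h0 _ fun h => he (Or.inr h), add_zero]

/-- A function on the edges of the curve which jumps only where legs arrive, and which takes the
same value on the two edges where a sector of the disc begins and ends, describes a boundary of
the surface with the target: the sum of the sectors on which its value is one. -/
theorem sum_elim_mem_range (hcap : C.IsCap S ext s) [Fintype (M.closedEdges S)]
    {k : ℕ} {u : Fin k → Fin C.length}
    (hu : u.Injective) (r : Equiv.Perm (Fin k)) {h : Fin C.length → ZMod 2}
    (h1 : ∀ i ∉ Set.range u, h (s i) = h i) (h2 : ∀ j, h (s (u (r j))) = h (u j)) :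
    Sum.elim (fun e => C.curveChain h e.1)
        (Sum.elim (fun j => h (u j) + h (s (u j))) fun j => h (u j) + h (s (u j)))
      ∈ LinearMap.range
        ((M.restrict (M.closedEdges S)).attachTarget (fun j => ext (u j)) r).boundaryTwo := by
  classical
  have hinj := hcap.ext_injective
  let g : Dart (M.closedEdges S) → ZMod 2 := fun d => ∑ i, if ext i = d then h i else 0
  have g1 : ∀ i, g (ext i) = h i := by
    intro i
    change ∑ i', (if ext i' = ext i then h i' else 0) = h i
    rw [Finset.sum_eq_single i]
    · simp
    · intro j _ hj
      rw [if_neg fun h => hj (hinj h)]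
    · simp
  have g0 : ∀ d ∉ Set.range ext, g d = 0 := fun d hd =>
    Finset.sum_eq_zero fun i _ => if_neg fun h => hd ⟨i, h⟩
  have key := (M.restrict (M.closedEdges S)).sum_elim_mem_range_boundaryTwo r
    (corner := fun j => ext (u j)) (hinj.comp hu) g ?_ ?_
  · convert key using 2
    · ext e
      simp only [dartBoundary, curveChain, g]
      rw [← Finset.sum_add_distrib]
      refine Finset.sum_congr rfl fun i _ => ?_
      have he : (C.dart i).1 = e.1 ↔ (ext i).1 = e := by
        rw [← hcap.edge, Subtype.ext_iff]
      generalize ext i = d at he ⊢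
      obtain ⟨x, b⟩ := d
      simp only [he, Prod.mk.injEq]
      by_cases hxe : x = e <;> cases b <;> simp [hxe]
    · simp only [hcap.flip_rot, g1]
  · intro d hd
    by_cases hd' : d ∈ Set.range ext
    · obtain ⟨i, rfl⟩ := hd'
      rw [hcap.flip_rot, g1, g1, h1]
      rintro ⟨j, rfl⟩
      exact hd ⟨j, rfl⟩
    · rw [g0 d hd', g0]
      rw [hcap.mem_range, not_not] at hd' ⊢
      rw [M.leftFace_restrict_flip_rot hd', M.leftFace_flip_rot]
      exact hd'
  · intro j
    rw [hcap.flip_rot, g1, g1, h2]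

end IsCap

/-! ### The two sides of the curve -/

/-- The darts of the curve on the first torus that have the capping disc to their left. -/
def leftExt (i : Fin C.length) : Dart (M.closedEdges C.left) :=
  (⟨(C.dart i).1, C.mem_left i⟩, !(C.dart i).2)

/-- The darts of the curve on the second torus that have the capping disc to their left. -/
def rightExt (i : Fin C.length) : Dart (M.closedEdges C.leftᶜ) :=
  (⟨(C.dart i).1, C.mem_right i⟩, (C.dart i).2)

theorem inclDart_leftExt (i : Fin C.length) : inclDart (C.leftExt i) = (C.dart i).flip := rfl

theorem inclDart_rightExt (i : Fin C.length) : inclDart (C.rightExt i) = C.dart i := rfl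

/-- The boundary walk of the disc on the left torus runs against the direction of the curve. -/
theorem inclDart_leftCap_rot_leftExt [Finite E] (i : Fin C.length) :
    inclDart (C.leftCap.rot (C.leftExt i)) = C.dart (i + 1) := by
  have h1 : M.leftFace (inclDart (C.leftCap.rot (C.leftExt i))).flip ∉ C.left :=
    M.leftFace_restrict_flip_rot_notMem (d := C.leftExt i) (C.leftFace_dart_flip i)
  have h2 : M.leftFace (inclDart (C.leftCap.rot (C.leftExt i))) ∈ C.left :=
    (M.mem_closedEdges_iff.mp (C.leftCap.rot (C.leftExt i)).1.2).resolve_right h1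
  obtain ⟨j, hj⟩ := (C.mem_range_dart_iff _).mpr ⟨h2, h1⟩
  have ht : M.tail (inclDart (C.leftCap.rot (C.leftExt i))) = M.tail (C.dart i).flip :=
    M.tail_inclDart_restrict_rot (C.leftExt i)
  rw [← hj] at ht ⊢
  rw [C.tail_dart_flip] at ht
  rw [C.simple ht]

/-- The boundary walk of the disc on the right torus runs along the curve; its direction is reversed
here, since the flip of the rotation leads to the preceding dart of the walk. -/
theorem flip_rightCap_rot_rightExt [Finite E] (i : Fin C.length) :
    (C.rightCap.rot (C.rightExt i)).flip = C.rightExt (i - 1) := by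
  have h1 : M.leftFace (inclDart (C.rightCap.rot (C.rightExt i))).flip ∉ C.leftᶜ :=
    M.leftFace_restrict_flip_rot_notMem (d := C.rightExt i)
      (fun h => h (C.leftFace_dart i))
  have h2 : M.leftFace (inclDart (C.rightCap.rot (C.rightExt i))) ∈ C.leftᶜ :=
    (M.mem_closedEdges_iff.mp (C.rightCap.rot (C.rightExt i)).1.2).resolve_right h1
  rw [Set.notMem_compl_iff] at h1
  obtain ⟨j, hj⟩ := (C.mem_range_dart_iff (inclDart (C.rightCap.rot (C.rightExt i))).flip).mpr
    ⟨h1, by rwa [Dart.flip_flip]⟩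
  have ht : M.tail (inclDart (C.rightCap.rot (C.rightExt i))) = M.tail (C.dart i) :=
    M.tail_inclDart_restrict_rot (C.rightExt i)
  rw [← Dart.flip_flip (inclDart _), ← hj, C.tail_dart_flip] at ht
  apply inclDart_injective
  rw [inclDart_flip, inclDart_rightExt, ← hj, ← C.simple ht, add_sub_cancel_right]

theorem eq_of_add_one_invariant {n : ℕ} [NeZero n] (h : Fin n → ZMod 2)
    (hs : ∀ i, h (i + 1) = h i) (i j : Fin n) : h i = h j := by
  have key : ∀ m : ℕ, h (Fin.ofNat n m) = h 0 := by
    intro m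
    induction m with
    | zero => rfl
    | succ m ih =>
      rw [← ih, ← hs (Fin.ofNat n m)]
      congr 1
      ext
      simp [Fin.ofNat, Fin.val_add]
  have key' : ∀ i : Fin n, h i = h 0 := fun i => by
    rw [← key i.1]; congr 1; ext; simp [Fin.ofNat, Nat.mod_eq_of_lt i.2]
  rw [key' i, key' j]

theorem isCap_leftExt [Finite E] : C.IsCap C.left C.leftExt (· + 1) where
  edge _ := rfl
  mem_range d := by
    constructor
    · rintro ⟨i, rfl⟩
      exact C.leftFace_dart_flip i
    · intro h
      have h2 := (M.mem_closedEdges_iff.mp d.1.2 : M.leftFace (inclDart d) ∈ C.left ∨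
        M.leftFace (inclDart d).flip ∈ C.left).resolve_left h
      obtain ⟨i, hi⟩ := (C.mem_range_dart_iff (inclDart d).flip).mpr
        ⟨h2, by rwa [Dart.flip_flip]⟩
      refine ⟨i, inclDart_injective ?_⟩
      rw [inclDart_leftExt, hi, Dart.flip_flip]
  flip_rot i := by
    apply inclDart_injective
    rw [inclDart_flip, inclDart_leftExt]
    exact congrArg Dart.flip (C.inclDart_leftCap_rot_leftExt i)
  eq_of_invariant := eq_of_add_one_invariant

theorem isCap_rightExt [Finite E] : C.IsCap C.leftᶜ C.rightExt (· - 1) where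
  edge _ := rfl
  mem_range d := by
    constructor
    · rintro ⟨i, rfl⟩ h
      exact h (C.leftFace_dart i)
    · intro h
      have h2 := (M.mem_closedEdges_iff.mp d.1.2 : M.leftFace (inclDart d) ∈ C.leftᶜ ∨
        M.leftFace (inclDart d).flip ∈ C.leftᶜ).resolve_left h
      obtain ⟨i, hi⟩ := (C.mem_range_dart_iff (inclDart d)).mpr ⟨not_not.mp h, h2⟩
      exact ⟨i, inclDart_injective hi⟩
  flip_rot := C.flip_rightCap_rot_rightExt
  eq_of_invariant h hs := eq_of_add_one_invariant h fun i => by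
    rw [← hs (i + 1), add_sub_cancel_right]

end SeparatingCurve

/-! ### Cyclic partial sums -/

section PartialSum

variable {n k : ℕ} (pos : Fin k → Fin n) (I : Fin k → ZMod 2)

/-- The number mod 2 of those positions `pos j` with `I j = 1` which are at most `i`. If their total
number is even, this function is well behaved on the cyclically ordered set `Fin n`: it jumps exactly
at these positions. -/
def partialSum (i : Fin n) : ZMod 2 := ∑ j, if pos j ≤ i then I j else 0

variable {pos I} [NeZero n]

theorem partialSum_sub_one (hI : ∑ j, I j = 0) (i : Fin n) :
    partialSum pos I (i - 1) = ∑ j, if pos j < i then I j else 0 := by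
  by_cases hi : i = 0
  -- Here `i - 1` is the last position, and the full sum vanishes.
  · subst hi
    rw [partialSum, Finset.sum_congr rfl (g := I), hI]
    · simp
    · intro j _
      rw [if_pos]
      rw [Fin.le_def, Fin.val_sub]
      have := (pos j).2
      obtain ⟨m, rfl⟩ := Nat.exists_eq_succ_of_ne_zero (NeZero.ne n)
      rcases Nat.eq_zero_or_pos m with rfl | hm
      · simp
      · have : ((1 : Fin (m + 1)) : ℕ) = 1 := by
          simp [Nat.mod_eq_of_lt (show 1 < m + 1 by omega)]
        simp [Nat.mod_eq_of_lt (show 1 < m + 1 by omega)]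
        omega
  · refine Finset.sum_congr rfl fun j _ => ?_
    have h1 : (i - 1).val = i.val - 1 := Fin.val_sub_one_of_ne_zero hi
    have h2 : i.val ≠ 0 := fun h => hi (Fin.ext h)
    have h3 : pos j ≤ i - 1 ↔ pos j < i := by
      rw [Fin.le_def, Fin.lt_def, h1]; omega
    simp only [h3]

theorem partialSum_sub_one_of_notMem (hI : ∑ j, I j = 0) {i : Fin n} (hi : i ∉ Set.range pos) :
    partialSum pos I (i - 1) = partialSum pos I i := by
  rw [partialSum_sub_one hI]
  refine Finset.sum_congr rfl fun j _ => ?_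
  have h : pos j < i ↔ pos j ≤ i :=
    ⟨le_of_lt, fun h => lt_of_le_of_ne h fun h => hi ⟨j, h⟩⟩
  simp only [h]

theorem partialSum_add_sub_one (hI : ∑ j, I j = 0) (hpos : pos.Injective) (j : Fin k) :
    partialSum pos I (pos j) + partialSum pos I (pos j - 1) = I j := by
  rw [partialSum_sub_one hI, partialSum, ← Finset.sum_add_distrib, Finset.sum_eq_single j]
  · simp
  · intro i _ hij
    have hne : pos i ≠ pos j := fun h => hij (hpos h)
    rcases lt_or_gt_of_ne hne with h | h
    · rw [if_pos h, if_pos h.le, CharTwo.add_self_eq_zero]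
    · rw [if_neg h.not_gt, if_neg h.not_ge, add_zero]
  · simp

/-- The partial sums do not change between a marked position and the next one, in cyclic order. -/
theorem partialSum_finRotate (hI : ∑ j, I j = 0) (hpos : StrictMono pos) (j : Fin k) :
    partialSum pos I (pos (finRotate k j) - 1) = partialSum pos I (pos j) := by
  rw [partialSum_sub_one hI, partialSum]
  simp only [hpos.lt_iff_lt, hpos.le_iff_le]
  obtain _ | k := k
  · exact j.elim0
  rw [finRotate_apply]
  by_cases hj : j = Fin.last k
  · subst hj
    simp [Fin.le_last, hI]
  · refine Finset.sum_congr rfl fun i _ => ?_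
    have h : i < j + 1 ↔ i ≤ j := by
      rw [Fin.lt_def, Fin.le_def, Fin.val_add_one_of_lt (Fin.lt_last_iff_ne_last.mpr hj)]
      omega
    simp only [h]

end PartialSum

namespace SeparatingCurve

variable {E : Type*} {M : CellSurface E} (C : M.SeparatingCurve)

/-! ### Pushing cycles out of the target -/

theorem extendChain_curveChain {P : Set E} (hP : ∀ i, (C.dart i).1 ∈ P)
    (h : Fin C.length → ZMod 2) :
    extendChain (fun e : P => C.curveChain h e.1) = C.curveChain h := by
  ext e
  by_cases he : e ∈ P
  · exact extendChain_of_mem _ he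
  · rw [extendChain_of_notMem _ he, C.curveChain_of_notMem]
    rintro i rfl
    exact he (hP i)

theorem add_extendToTarget_eq {P : Set E} {k : ℕ} (c : P ⊕ TargetEdge k → ZMod 2) (I : Fin k → ZMod 2)
    (K : P → ZMod 2) (h1 : ∀ j, c (Sum.inr (Sum.inl j)) = I j)
    (h2 : ∀ j, c (Sum.inr (Sum.inr j)) = I j) :
    c + extendToTarget ((fun e => c (Sum.inl e)) + K) = Sum.elim K (Sum.elim I I) := by
  ext e
  obtain e | j | j := e
  · change c _ + (c _ + _) = _
    rw [← add_assoc, CharTwo.add_self_eq_zero, zero_add]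
    rfl
  · exact (add_zero _).trans (h1 j)
  · exact (add_zero _).trans (h2 j)

variable [Fintype E]

open scoped Classical in
/-- The closure of the region `S` on one side of the curve, with the target drawn correctly into its
capping disc: chains that bound after capping bound in the whole surface, and every even set of legs
bounds together with arcs of the curve between the end vertices of these legs. This is all that
the gluing formula needs to know about a side of the curve. -/
structure IsSide {S : Set M.Face} {k : ℕ} (corner : Fin k → Dart (M.closedEdges S))
    (r : Equiv.Perm (Fin k)) (pos : Fin k → Fin C.length) : Prop where
  corner_injective : corner.Injective
  dart_mem : ∀ i, (C.dart i).1 ∈ M.closedEdges S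
  extendChain_mem_range : ∀ a ∈ LinearMap.range (M.restrict (M.closedEdges S)).boundaryTwo,
    extendChain a ∈ LinearMap.range M.boundaryTwo
  legs_mem_range : ∀ I : Fin k → ZMod 2, ∑ j, I j = 0 →
    Sum.elim (fun e => C.curveChain (partialSum pos I) e.1) (Sum.elim I I) ∈
      LinearMap.range ((M.restrict (M.closedEdges S)).attachTarget corner r).boundaryTwo

theorem isSide_left {k : ℕ} {pos : Fin k → Fin C.length} (hpos : StrictMono pos) :
    C.IsSide (fun j => C.leftCap.rot⁻¹ (⟨(C.dart (pos j)).1, C.mem_left _⟩, (C.dart (pos j)).2))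
      (finRotate k)⁻¹ pos := by
  classical
  have hcorner : (fun j => C.leftCap.rot⁻¹
      ((⟨(C.dart (pos j)).1, C.mem_left _⟩, (C.dart (pos j)).2) : Dart (M.closedEdges C.left)))
      = fun j => C.leftExt (pos j - 1) := by
    funext j
    rw [Equiv.Perm.inv_eq_iff_eq]
    apply inclDart_injective
    rw [C.inclDart_leftCap_rot_leftExt, sub_add_cancel]
    rfl
  rw [hcorner]
  have hinj : Function.Injective fun j => pos j - 1 := fun i j h =>
    hpos.injective (sub_left_injective h)
  refine ⟨C.isCap_leftExt.ext_injective.comp hinj, C.mem_left,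
    fun a ha => C.isCap_leftExt.extendChain_mem_range ha, fun I hI => ?_⟩
  have key := C.isCap_leftExt.sum_elim_mem_range hinj (finRotate k)⁻¹ (h := partialSum pos I) ?_ ?_
  · convert key using 2
    have h : I = fun j => partialSum pos I (pos j - 1) + partialSum pos I (pos j - 1 + 1) := by
      funext j
      rw [sub_add_cancel, add_comm, partialSum_add_sub_one hI hpos.injective]
    rw [← h]
  · intro i hi
    have h := partialSum_sub_one_of_notMem hI (pos := pos) (i := i + 1) ?_
    · rw [← h, add_sub_cancel_right]
    · rintro ⟨j, hj⟩
      exact hi ⟨j, by simp [hj]⟩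
  · intro j
    have h := partialSum_finRotate hI hpos ((finRotate k)⁻¹ j)
    rw [show finRotate k ((finRotate k)⁻¹ j) = j from (finRotate k).apply_symm_apply j] at h
    rw [h, sub_add_cancel]

theorem isSide_right {k : ℕ} {pos : Fin k → Fin C.length} (hpos : StrictMono pos) :
    C.IsSide (fun j => ((⟨(C.dart (pos j)).1, C.mem_right _⟩, (C.dart (pos j)).2) :
      Dart (M.closedEdges C.leftᶜ))) (finRotate k) pos := by
  classical
  refine ⟨C.isCap_rightExt.ext_injective.comp hpos.injective, C.mem_right,
    fun a ha => C.isCap_rightExt.extendChain_mem_range ha, fun I hI => ?_⟩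
  have key := C.isCap_rightExt.sum_elim_mem_range hpos.injective (finRotate k)
    (h := partialSum pos I) (fun i hi => partialSum_sub_one_of_notMem hI hi)
    (fun j => partialSum_finRotate hI hpos j)
  simp only [partialSum_add_sub_one hI hpos.injective] at key
  exact key

namespace IsSide

variable {C} {S : Set M.Face} {k : ℕ} {corner : Fin k → Dart (M.closedEdges S)}
  {r : Equiv.Perm (Fin k)} {pos : Fin k → Fin C.length}

open scoped Classical in
theorem add_extendToTarget_mem_range (hS : C.IsSide corner r pos)
    {c : M.closedEdges S ⊕ TargetEdge k → ZMod 2}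
    (hc : c ∈ ((M.restrict (M.closedEdges S)).attachTarget corner r).Cycles) :
    c + extendToTarget ((fun e => c (Sum.inl e)) +
        fun e => C.curveChain (partialSum pos fun j => c (Sum.inr (Sum.inr j))) e.1) ∈
      LinearMap.range ((M.restrict (M.closedEdges S)).attachTarget corner r).boundaryTwo := by
  rw [add_extendToTarget_eq c (fun j => c (Sum.inr (Sum.inr j))) _
    (cycle_inner_eq_outer _ r hS.corner_injective hc) fun _ => rfl]
  exact hS.legs_mem_range _ (cycle_sum_legs _ r hS.corner_injective hc)

open scoped Classical in
theorem existsUnique_isRestriction (hS : C.IsSide corner r pos) (q : M.QuadForm) :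
    ∃! q' : ((M.restrict (M.closedEdges S)).attachTarget corner r).QuadForm,
      IsRestriction q ((M.restrict (M.closedEdges S)).attachTarget corner r) q' :=
  M.existsUnique_isRestriction r hS.corner_injective
    (fun _ hc => ⟨_, hS.add_extendToTarget_mem_range hc⟩) hS.extendChain_mem_range q

open scoped Classical in
/-- A chain that contains both edges of the legs in `I` is a cycle if and only if replacing these legs
by arcs of the curve turns it into a cycle. -/
theorem mem_cycles_iff (hS : C.IsSide corner r pos) {c : M.closedEdges S ⊕ TargetEdge k → ZMod 2}
    {I : Fin k → ZMod 2} (hI : ∑ j, I j = 0)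
    (h1 : ∀ j, c (Sum.inr (Sum.inl j)) = I j) (h2 : ∀ j, c (Sum.inr (Sum.inr j)) = I j) :
    c ∈ ((M.restrict (M.closedEdges S)).attachTarget corner r).Cycles ↔
      extendChain (fun e : M.closedEdges S => c (Sum.inl e)) + C.curveChain (partialSum pos I) ∈
        M.Cycles := by
  have hK : extendChain (fun e : M.closedEdges S => c (Sum.inl e)) +
      C.curveChain (partialSum pos I) = extendChain ((fun e : M.closedEdges S => c (Sum.inl e)) +
        fun e => C.curveChain (partialSum pos I) e.1) := by
    rw [extendChain_add, C.extendChain_curveChain hS.dart_mem]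
  rw [hK, ← M.extendToTarget_mem_cycles_iff r hS.corner_injective]
  have h := add_extendToTarget_eq c I (fun e => C.curveChain (partialSum pos I) e.1) h1 h2
  obtain ⟨f, hf⟩ := hS.legs_mem_range I hI
  have hmem := boundaryTwo_mem_cycles _ f
  rw [hf, ← h] at hmem
  exact ⟨fun hc => (Submodule.add_mem_iff_right _ hc).mp hmem,
    fun hc => (Submodule.add_mem_iff_left _ hc).mp hmem⟩

open scoped Classical in
/-- The value of the restricted form on a cycle through the target: the cycle may be pushed out
of the disc onto the curve. -/
theorem restriction_apply (hS : C.IsSide corner r pos) {q : M.QuadForm}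
    {q' : ((M.restrict (M.closedEdges S)).attachTarget corner r).QuadForm}
    (hq : IsRestriction q ((M.restrict (M.closedEdges S)).attachTarget corner r) q')
    {c : M.closedEdges S ⊕ TargetEdge k → ZMod 2} {I : Fin k → ZMod 2}
    (hc : c ∈ ((M.restrict (M.closedEdges S)).attachTarget corner r).Cycles)
    (hI : ∀ j, c (Sum.inr (Sum.inr j)) = I j)
    (hc' : extendChain (fun e : M.closedEdges S => c (Sum.inl e)) +
      C.curveChain (partialSum pos I) ∈ M.Cycles) :
    q'.1 (homologyClass _ c hc) = q.1 (M.homologyClass _ hc') := by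
  obtain rfl : (fun j => c (Sum.inr (Sum.inr j))) = I := funext hI
  have hK : extendChain (fun e : M.closedEdges S => c (Sum.inl e)) +
      C.curveChain (partialSum pos fun j => c (Sum.inr (Sum.inr j)))
      = extendChain ((fun e : M.closedEdges S => c (Sum.inl e)) +
        fun e => C.curveChain (partialSum pos fun j => c (Sum.inr (Sum.inr j))) e.1) := by
    rw [extendChain_add, C.extendChain_curveChain hS.dart_mem]
  have hc2 := hc'
  rw [hK] at hc2
  rw [M.homologyClass_congr hc' hK, ← hq _ hc2
    ((M.extendToTarget_mem_cycles_iff r hS.corner_injective).mpr hc2)]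
  exact congrArg q'.1 (homologyClass_eq _ hc _ (hS.add_extendToTarget_mem_range hc))

end IsSide

/-! ### Cycles on different sides of the curve -/

/-- Cycles on different sides of the curve do not cross: the first one can be pushed off the
1-skeleton so that it stays in the interior of the left side. -/
theorem intersectionForm_eq_zero {a b : E → ZMod 2} (ha : a ∈ M.Cycles) (hb : b ∈ M.Cycles)
    (ha' : ∀ e ∉ M.closedEdges C.left, a e = 0) (hb' : ∀ e ∉ M.closedEdges C.leftᶜ, b e = 0) :
    M.intersectionForm (M.homologyClass a ha) (M.homologyClass b hb) = 0 := by
  classical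
  obtain ⟨p, hp⟩ := M.exists_isPotential a ha
  -- `κ` is the value of the potential on the right side of a vertex on the curve.
  obtain ⟨κ, hκ⟩ : ∃ κ : M.Vertex → ZMod 2, ∀ i, κ (M.tail (C.dart i)) = p (C.dart i) :=
    ⟨Function.extend (fun i => M.tail (C.dart i)) (fun i => p (C.dart i)) 0,
      fun i => C.simple.extend_apply _ _ i⟩
  have hrestrict : a = extendChain (fun e : M.closedEdges C.left => a e.1) := by
    ext e
    by_cases he : e ∈ M.closedEdges C.left
    · rw [extendChain_of_mem _ he]
    · rw [extendChain_of_notMem _ he, ha' e he]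
  -- The potential is constant on the right side of each vertex on the curve.
  have hturn : ∀ i, p (C.dart (i + 1)) = p (C.dart i).flip + a (C.dart i).1 := by
    intro i
    have h := hp
    rw [hrestrict] at h
    have h' := M.isPotential_restrict h (C.leftExt i)
    exact (congrArg p (C.inclDart_leftCap_rot_leftExt i)).symm.trans h'
  -- Normalise the potential to vanish on the right side of the curve.
  let p' : Dart E → ZMod 2 := fun d =>
    if M.leftFace d.flip ∈ C.left then p d + κ (M.tail d) else 0
  have hp' : M.IsPotential a p' := by
    intro d
    simp only [p', M.leftFace_flip_rot, M.tail_rot]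
    by_cases h1 : M.leftFace d ∈ C.left <;> by_cases h2 : M.leftFace d.flip ∈ C.left
    · rw [if_pos h1, if_pos h2, hp]
      ring
    · rw [if_pos h1, if_neg h2]
      obtain ⟨i, rfl⟩ := (C.mem_range_dart_iff d).mpr ⟨h1, h2⟩
      rw [hκ, hp, add_right_comm, CharTwo.add_self_eq_zero]
    · rw [if_neg h1, if_pos h2]
      obtain ⟨i, hi⟩ := (C.mem_range_dart_iff d.flip).mpr ⟨h2, by rwa [Dart.flip_flip]⟩
      obtain rfl : d = (C.dart i).flip := by rw [hi, Dart.flip_flip]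
      rw [C.tail_dart_flip, hκ, hturn, Dart.flip_fst]
      linear_combination (-1 : ZMod 2) * CharTwo.add_self_eq_zero (p (C.dart i).flip)
        - CharTwo.add_self_eq_zero (a (C.dart i).1)
    · rw [if_neg h1, if_neg h2, ha', zero_add]
      exact fun h => (M.mem_closedEdges_iff.mp h).elim h1 h2
  rw [M.intersectionForm_homologyClass ⟨a, ha⟩ ⟨b, hb⟩ p' hp']
  refine Finset.sum_eq_zero fun e _ => ?_
  by_cases he : e ∈ M.closedEdges C.leftᶜ
  · obtain ⟨d, rfl, hd⟩ : ∃ d : Dart E, d.1 = e ∧ M.leftFace d.flip ∉ C.left := by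
      rcases he with he | he
      · exact ⟨(e, false), rfl, he⟩
      · exact ⟨(e, true), rfl, he⟩
    have h1 : p' d = 0 := if_neg hd
    have h2 : p' d.flip + a d.1 = 0 := by
      rw [← Dart.flip_fst d, ← hp' d.flip]
      exact if_neg (by rwa [M.leftFace_flip_rot])
    have h3 := dartBoundary_apply p' d
    rw [dartBoundary] at h3
    rw [h3, h1, zero_add, h2, zero_mul]
  · change _ * b e = 0
    rw [hb' e he, mul_zero]

/-- Away from the curve, the part of a cycle on the left side of the curve has no boundary. -/
theorem boundaryOne_extendChain_of_notMem {a : E → ZMod 2} (ha : a ∈ M.Cycles) {v : M.Vertex}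
    (hv : ∀ i, M.tail (C.dart i) ≠ v) :
    M.boundaryOne (extendChain fun e : M.closedEdges C.left => a e.1) v = 0 := by
  classical
  have hinv : ∀ d, M.tail d = v →
      (M.leftFace (M.rot d) ∈ C.left ↔ M.leftFace d ∈ C.left) := by
    intro d hd
    by_contra hne
    have ht : M.tail (M.rot d) = v := by rw [M.tail_rot, hd]
    rw [← M.leftFace_flip_rot d] at hne
    by_cases h1 : M.leftFace (M.rot d) ∈ C.left
    · obtain ⟨i, hi⟩ := (C.mem_range_dart_iff (M.rot d)).mpr ⟨h1, by tauto⟩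
      exact hv i (by rw [hi, ht])
    · obtain ⟨i, hi⟩ := (C.mem_range_dart_iff (M.rot d).flip).mpr
        ⟨by tauto, by rwa [Dart.flip_flip]⟩
      exact hv (i + 1) (by rw [← C.tail_dart_flip, hi, Dart.flip_flip, ht])
  have hconst : ∀ d d', M.tail d = v → M.tail d' = v →
      (M.leftFace d' ∈ C.left ↔ M.leftFace d ∈ C.left) := by
    intro d d' hd hd'
    have h := M.eq_of_tail_eq (g := fun d => M.leftFace d ∈ C.left) (hd.trans hd'.symm)
      fun x hx => propext (hinv x (hx.trans hd))
    exact iff_of_eq h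
  rw [boundaryOne_apply]
  by_cases h : ∃ d, M.tail d = v ∧ M.leftFace d ∈ C.left
  · obtain ⟨d, hd, hd'⟩ := h
    have hav := congrFun (LinearMap.mem_ker.mp ha) v
    rw [boundaryOne_apply] at hav
    refine Eq.trans ?_ hav
    refine Finset.sum_congr rfl fun x hx => ?_
    have hx' := (Finset.mem_filter.mp hx).2
    have hmem : x.1 ∈ M.closedEdges C.left :=
      M.mem_closedEdges_iff.mpr (Or.inl ((hconst d x hd hx').mpr hd'))
    exact extendChain_of_mem _ hmem
  · refine Finset.sum_eq_zero fun x hx => ?_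
    have hx' := (Finset.mem_filter.mp hx).2
    refine extendChain_of_notMem _ fun hmem => h ?_
    have hrot : M.rot (M.rot⁻¹ x) = x := M.rot.apply_symm_apply x
    rcases M.mem_closedEdges_iff.mp hmem with hm | hm
    · exact ⟨x, hx', hm⟩
    · refine ⟨M.rot⁻¹ x, ?_, ?_⟩
      · rw [← M.tail_rot, hrot, hx']
      · rwa [← M.leftFace_flip_rot, hrot]

open scoped Classical in
theorem boundaryOne_edge (d : Dart E) (v : M.Vertex) :
    M.boundaryOne (fun e => if d.1 = e then 1 else 0) v
      = (if M.tail d = v then 1 else 0) + if M.tail d.flip = v then 1 else 0 := by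
  rw [boundaryOne_apply, Finset.sum_filter, Fintype.sum_prod_type, Finset.sum_eq_single d.1]
  · obtain ⟨e, b⟩ := d
    simp only [Fintype.sum_bool, if_true]
    cases b
    · exact add_comm _ _
    · rfl
  · intro e _ he
    simp [he.symm]
  · simp

open scoped Classical in
theorem boundaryOne_curveChain (h : Fin C.length → ZMod 2) (v : M.Vertex) :
    M.boundaryOne (C.curveChain h) v
      = ∑ i, if M.tail (C.dart i) = v then h i + h (i - 1) else 0 := by
  have h1 : C.curveChain h = ∑ i, h i • fun e => if (C.dart i).1 = e then (1 : ZMod 2) else 0 := by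
    ext e
    simp [curveChain, Finset.sum_apply]
  rw [h1, map_sum, Finset.sum_apply]
  simp only [map_smul, Pi.smul_apply, smul_eq_mul, boundaryOne_edge, mul_add, mul_ite, mul_one,
    mul_zero, C.tail_dart_flip]
  rw [Finset.sum_add_distrib, ← Equiv.sum_comp (Equiv.subRight (1 : Fin C.length))
    (fun i => if M.tail (C.dart (i + 1)) = v then h i else 0), ← Finset.sum_add_distrib]
  refine Finset.sum_congr rfl fun i _ => ?_
  simp only [Equiv.subRight_apply, sub_add_cancel]
  split_ifs <;> simp

theorem boundaryOne_curveChain_tail (h : Fin C.length → ZMod 2) (i : Fin C.length) :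
    M.boundaryOne (C.curveChain h) (M.tail (C.dart i)) = h i + h (i - 1) := by
  classical
  rw [boundaryOne_curveChain, Finset.sum_eq_single i]
  · simp
  · intro j _ hj
    rw [if_neg fun h => hj (C.simple h)]
  · simp

theorem boundaryOne_curveChain_of_notMem (h : Fin C.length → ZMod 2) {v : M.Vertex}
    (hv : ∀ i, M.tail (C.dart i) ≠ v) : M.boundaryOne (C.curveChain h) v = 0 := by
  classical
  rw [boundaryOne_curveChain]
  exact Finset.sum_eq_zero fun i _ => if_neg (hv i)

end SeparatingCurve

end CellSurface

/-! ### The pairing of the gluing variables -/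

/-- A product of basis vectors in strictly increasing order is a basis monomial. -/
theorem prod_map_ι_eq {R M I : Type*} [CommRing R] [AddCommGroup M] [Module R M] [LinearOrder I]
    (b : Module.Basis I R M) {l : List I} (hl : l.SortedLT) {s : Finset I}
    (hs : ∀ i, i ∈ l ↔ i ∈ s) :
    (l.map fun i => ExteriorAlgebra.ι R (b i)).prod = b.ExteriorAlgebra s := by
  obtain rfl : l = s.sort :=
    hl.eq_of_mem_iff s.sortedLT_sort (by simpa using hs)
  rw [ExteriorAlgebra.basis_apply_ofCard b rfl, ExteriorAlgebra.ιMulti_family,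
    ExteriorAlgebra.ιMulti_apply]
  congr 1
  refine List.ext_getElem (by simp) fun i h1 h2 => ?_
  simp only [List.getElem_map, List.getElem_ofFn, Function.comp_apply]
  rfl

section Monomials

variable {R : Type*} [CommRing R] {k : ℕ}

/-- The index of the gluing variable of an edge of the target, in the first graph. -/
def leftIndex : CellSurface.TargetEdge k → GluingIndex k
  | Sum.inl i => toLex (i, 0)
  | Sum.inr i => toLex (i, 1)

/-- The index of the gluing variable of an edge of the target, in the second graph. -/
def rightIndex : CellSurface.TargetEdge k → GluingIndex k
  | Sum.inl i => toLex (i, 1)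
  | Sum.inr i => toLex (i, 0)

theorem leftTargetVar_eq : (leftTargetVar : CellSurface.TargetEdge k → GluingAlgebra R k)
    = fun t => ExteriorAlgebra.ι R (gluingBasis R k (leftIndex t)) := by
  funext t
  cases t <;> rfl

theorem rightTargetVar_eq : (rightTargetVar : CellSurface.TargetEdge k → DualGluingAlgebra R k)
    = fun t => ExteriorAlgebra.ι R
        (dualGluingBasis R k (OrderDual.toDual (rightIndex t))) := by
  funext t
  cases t <;> rfl

theorem mem_leftOrder (t : CellSurface.TargetEdge k) : t ∈ leftOrder k := by
  cases t <;> simp [leftOrder]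

theorem mem_rightOrder (t : CellSurface.TargetEdge k) : t ∈ rightOrder k := by
  cases t <;> simp [rightOrder]

theorem pairwise_leftOrder :
    (leftOrder k).Pairwise fun s t => leftIndex s < leftIndex t := by
  rw [leftOrder, List.pairwise_flatMap]
  constructor
  · intro i _
    simp [leftIndex, Prod.Lex.toLex_lt_toLex]
  · refine (List.sortedLT_finRange k).pairwise.imp fun {i j} hij s hs t ht => ?_
    simp only [List.mem_cons, List.not_mem_nil, or_false] at hs ht
    rcases hs with rfl | rfl <;> rcases ht with rfl | rfl <;>
      simp [leftIndex, Prod.Lex.toLex_lt_toLex, hij]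

theorem pairwise_rightOrder :
    (rightOrder k).Pairwise fun s t => rightIndex t < rightIndex s := by
  rw [rightOrder, List.pairwise_flatMap]
  constructor
  · intro i _
    simp [rightIndex, Prod.Lex.toLex_lt_toLex]
  · rw [List.pairwise_reverse]
    refine (List.sortedLT_finRange k).pairwise.imp fun {i j} hij s hs t ht => ?_
    simp only [List.mem_cons, List.not_mem_nil, or_false] at hs ht
    rcases hs with rfl | rfl <;> rcases ht with rfl | rfl <;>
      simp [rightIndex, Prod.Lex.toLex_lt_toLex, hij]

variable {E : Type*} [Fintype E] {P : Set E}

open scoped Classical in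
/-- The product of the scalar variables of a set of edges outside the target. -/
def scalarPart (x : E → R) (A : Finset (P ⊕ CellSurface.TargetEdge k)) : R :=
  ∏ e : P with Sum.inl e ∈ A, x e.1

open scoped Classical in
/-- The indices of the gluing variables of a set of edges. -/
def indexSet (idx : CellSurface.TargetEdge k → GluingIndex k)
    (A : Finset (P ⊕ CellSurface.TargetEdge k)) : Finset (GluingIndex k) :=
  Finset.image idx {t | Sum.inr t ∈ A}

theorem gluingMonomial_left (x : E → R) (A : Finset (P ⊕ CellSurface.TargetEdge k)) :
    gluingMonomial x leftTargetVar (leftOrder k) A =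
      scalarPart x A • (gluingBasis R k).ExteriorAlgebra (indexSet leftIndex A) := by
  classical
  rw [gluingMonomial, ← Algebra.smul_def, scalarPart]
  congr 1
  rw [leftTargetVar_eq, ← prod_map_ι_eq (l := ((leftOrder k).filter fun t => Sum.inr t ∈ A).map
    leftIndex), List.map_map]
  · rfl
  · exact (List.pairwise_map.mpr (pairwise_leftOrder.filter _)).sortedLT
  · intro i
    simp [indexSet, mem_leftOrder]

theorem gluingMonomial_right (x : E → R) (A : Finset (P ⊕ CellSurface.TargetEdge k)) :
    gluingMonomial x rightTargetVar (rightOrder k) A =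
      scalarPart x A • (dualGluingBasis R k).ExteriorAlgebra
        ((indexSet rightIndex A).map OrderDual.toDual.toEmbedding) := by
  classical
  rw [gluingMonomial, ← Algebra.smul_def, scalarPart]
  congr 1
  rw [rightTargetVar_eq, ← prod_map_ι_eq (l := ((rightOrder k).filter fun t => Sum.inr t ∈ A).map
    fun t => OrderDual.toDual (rightIndex t)), List.map_map]
  · rfl
  · exact (List.pairwise_map.mpr (pairwise_rightOrder.filter _)).sortedLT
  · intro i
    simp [indexSet, mem_rightOrder]
    exact Iff.rfl

open scoped Classical in
theorem scalarProduct_sum {α β : Type*} [Fintype α] [Fintype β] (f : α → R) (g : β → R)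
    (s : α → Finset (GluingIndex k)) (t : β → Finset (GluingIndex k)) :
    scalarProduct (∑ a, f a • (gluingBasis R k).ExteriorAlgebra (s a))
        (∑ b, g b • (dualGluingBasis R k).ExteriorAlgebra
          ((t b).map OrderDual.toDual.toEmbedding))
      = ∑ p : α × β with s p.1 = t p.2, f p.1 * g p.2 := by
  simp only [scalarProduct, map_sum, map_smul, Module.Basis.repr_self, Finsupp.coe_finsetSum,
    Finset.sum_apply, Finsupp.smul_apply, Finsupp.single_apply, Finset.map_inj, smul_eq_mul,
    mul_ite, mul_one, mul_zero, Finset.sum_mul_sum]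
  rw [Finset.sum_comm, Finset.sum_filter, Fintype.sum_prod_type]
  refine Finset.sum_congr rfl fun a _ => ?_
  rw [Finset.sum_comm]
  refine Finset.sum_congr rfl fun b _ => ?_
  simp only [ite_mul, zero_mul]
  rw [Finset.sum_ite_eq]
  simp

end Monomials

namespace CellSurface

/-! ### Cutting an even set along the curve -/

theorem neg_one_pow_val_add {R : Type*} [Ring R] (a b : ZMod 2) :
    (-1 : R) ^ (a + b).val = (-1) ^ a.val * (-1) ^ b.val := by
  have h : (1 + 1 : ZMod 2) = 0 := rfl
  have h1 : (1 : ZMod 2).val = 1 := rfl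
  rcases zmod_two_cases a with rfl | rfl <;> rcases zmod_two_cases b with rfl | rfl <;>
    simp [h, h1]

theorem neg_one_pow_mul_smul {R S : Type*} [CommRing R] [Ring S] [Algebra R S] (n : ℕ) (r : R)
    (y : S) : (-1 : S) ^ n * r • y = ((-1) ^ n * r) • y := by
  rcases neg_one_pow_eq_or S n with h | h <;> rcases Nat.even_or_odd n with h' | h' <;>
    simp [h'.neg_one_pow]

open scoped Classical in
theorem EmbeddedGraph.mem_withTarget_iff {E : Type*} [Fintype E] {M : CellSurface E}
    (G : M.EmbeddedGraph) {P : Set E} {k : ℕ} (e : P ⊕ TargetEdge k) :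
    e ∈ G.withTarget P k ↔ ∀ e' : P, e = Sum.inl e' → e'.1 ∈ G.edges := by
  simp [EmbeddedGraph.withTarget]

theorem mem_indexSet_supp {E : Type*} {P : Set E} [Fintype P] {k : ℕ}
    {c : P ⊕ TargetEdge k → ZMod 2}
    (hc : ∀ j, c (Sum.inr (Sum.inl j)) = c (Sum.inr (Sum.inr j))) (i : Fin k) (ε : Fin 2) :
    (toLex (i, ε) ∈ indexSet leftIndex (supp c) ↔ c (Sum.inr (Sum.inr i)) = 1) ∧
    (toLex (i, ε) ∈ indexSet rightIndex (supp c) ↔ c (Sum.inr (Sum.inr i)) = 1) := by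
  fin_cases ε <;> simp [indexSet, leftIndex, rightIndex, supp, hc]

/-- The monomials of two even sets are dual to each other if and only if the sets contain the same
legs of the target. -/
theorem indexSet_eq_iff {E : Type*} {P P' : Set E} [Fintype P] [Fintype P'] {k : ℕ}
    {c : P ⊕ TargetEdge k → ZMod 2} {c' : P' ⊕ TargetEdge k → ZMod 2}
    (hc : ∀ j, c (Sum.inr (Sum.inl j)) = c (Sum.inr (Sum.inr j)))
    (hc' : ∀ j, c' (Sum.inr (Sum.inl j)) = c' (Sum.inr (Sum.inr j))) :
    indexSet leftIndex (supp c) = indexSet rightIndex (supp c') ↔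
      ∀ j, c (Sum.inr (Sum.inr j)) = c' (Sum.inr (Sum.inr j)) := by
  have hz : ∀ y z : ZMod 2, (y = 1 ↔ z = 1) ↔ y = z := by decide
  constructor
  · intro h j
    rw [← hz, ← (mem_indexSet_supp hc j 0).1, ← (mem_indexSet_supp hc' j 0).2, h]
  · intro h
    ext g
    obtain ⟨⟨j, ε⟩, rfl⟩ := toLex.surjective g
    rw [(mem_indexSet_supp hc j ε).1, (mem_indexSet_supp hc' j ε).2, h]

theorem add_cancel_middle {E : Type*} (a b c : E → ZMod 2) : (a + c) + (b + c) = a + b := by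
  rw [add_add_add_comm, show c + c = 0 from funext fun e => CharTwo.add_self_eq_zero _, add_zero]

section Monomials

variable {E : Type*} [Fintype E] {P : Set E} {R : Type*} [CommRing R] {k : ℕ}

open scoped Classical in
theorem signedEvenSum_left (N : CellSurface (P ⊕ TargetEdge k)) (A : Finset (P ⊕ TargetEdge k))
    (q : N.QuadForm) (x : E → R) :
    N.signedEvenSum A q (gluingMonomial x leftTargetVar (leftOrder k)) =
      ∑ c : N.CyclesIn A, ((-1) ^ (q.1 (N.homologyClass c.1 c.2.1)).val *
        scalarPart x (supp c.1)) •
          (gluingBasis R k).ExteriorAlgebra (indexSet leftIndex (supp c.1)) := by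
  rw [signedEvenSum_eq]
  refine Finset.sum_congr rfl fun c _ => ?_
  rw [gluingMonomial_left]
  exact neg_one_pow_mul_smul _ _ _

open scoped Classical in
theorem signedEvenSum_right (N : CellSurface (P ⊕ TargetEdge k)) (A : Finset (P ⊕ TargetEdge k))
    (q : N.QuadForm) (x : E → R) :
    N.signedEvenSum A q (gluingMonomial x rightTargetVar (rightOrder k)) =
      ∑ c : N.CyclesIn A, ((-1) ^ (q.1 (N.homologyClass c.1 c.2.1)).val *
        scalarPart x (supp c.1)) •
          (dualGluingBasis R k).ExteriorAlgebra
            ((indexSet rightIndex (supp c.1)).map OrderDual.toDual.toEmbedding) := by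
  rw [signedEvenSum_eq]
  refine Finset.sum_congr rfl fun c _ => ?_
  rw [gluingMonomial_right]
  exact neg_one_pow_mul_smul _ _ _

end Monomials

namespace SeparatingCurve

variable {E : Type*} {M : CellSurface E} (C : M.SeparatingCurve)

theorem exists_dart_of_mem {e : E} (h1 : e ∈ M.closedEdges C.left)
    (h2 : e ∈ M.closedEdges C.leftᶜ) : ∃ i, (C.dart i).1 = e := by
  have key : ∀ d : Dart E, M.leftFace d ∈ C.left → M.leftFace d.flip ∉ C.left →
      ∃ i, (C.dart i).1 = d.1 := fun d h h' => by
    obtain ⟨i, hi⟩ := (C.mem_range_dart_iff d).mpr ⟨h, h'⟩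
    exact ⟨i, by rw [hi]⟩
  rcases h1 with h1 | h1 <;> rcases h2 with h2 | h2
  · exact absurd h1 h2
  · exact key (e, true) h1 h2
  · exact key (e, false) h1 h2
  · exact absurd h1 h2

theorem mem_right_of_notMem {e : E} (h : e ∉ M.closedEdges C.left) : e ∈ M.closedEdges C.leftᶜ :=
  Or.inl fun h' => h (Or.inl h')

theorem eq_add_extendChain {a : E → ZMod 2} (ha : ∀ i, a (C.dart i).1 = 0) :
    a = extendChain (fun e : M.closedEdges C.left => a e.1) +
      extendChain (fun e : M.closedEdges C.leftᶜ => a e.1) := by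
  ext e
  rw [Pi.add_apply]
  by_cases h1 : e ∈ M.closedEdges C.left
  · rw [extendChain_of_mem _ h1]
    by_cases h2 : e ∈ M.closedEdges C.leftᶜ
    · obtain ⟨i, rfl⟩ := C.exists_dart_of_mem h1 h2
      rw [extendChain_of_mem _ h2, ha, add_zero]
    · rw [extendChain_of_notMem _ h2, add_zero]
  · rw [extendChain_of_notMem _ h1, extendChain_of_mem _ (C.mem_right_of_notMem h1), zero_add]

theorem add_extendChain_left {C : M.SeparatingCurve} {G : M.EmbeddedGraph} (hCG : C.MeetsInVertices G)
    {b₁ : M.closedEdges C.left → ZMod 2} {b₂ : M.closedEdges C.leftᶜ → ZMod 2}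
    (h₂ : ∀ e, e.1 ∉ G.edges → b₂ e = 0) (e : M.closedEdges C.left) :
    (extendChain b₁ + extendChain b₂) e.1 = b₁ e := by
  rw [Pi.add_apply, extendChain_of_mem _ e.2]
  by_cases h : e.1 ∈ M.closedEdges C.leftᶜ
  · obtain ⟨i, hi⟩ := C.exists_dart_of_mem e.2 h
    rw [extendChain_of_mem _ h, h₂ _ (hi ▸ hCG i), add_zero]
  · rw [extendChain_of_notMem _ h, add_zero]

theorem add_extendChain_right {C : M.SeparatingCurve} {G : M.EmbeddedGraph} (hCG : C.MeetsInVertices G)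
    {b₁ : M.closedEdges C.left → ZMod 2} {b₂ : M.closedEdges C.leftᶜ → ZMod 2}
    (h₁ : ∀ e, e.1 ∉ G.edges → b₁ e = 0) (e : M.closedEdges C.leftᶜ) :
    (extendChain b₁ + extendChain b₂) e.1 = b₂ e := by
  rw [Pi.add_apply, extendChain_of_mem _ e.2]
  by_cases h : e.1 ∈ M.closedEdges C.left
  · obtain ⟨i, hi⟩ := C.exists_dart_of_mem h e.2
    rw [extendChain_of_mem _ h, h₁ _ (hi ▸ hCG i), zero_add]
  · rw [extendChain_of_notMem _ h, zero_add]

open scoped Classical in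
/-- The monomial of a set of edges off the curve is the product of the monomials of its parts. -/
theorem prod_supp_eq [Fintype E] {R : Type*} [CommRing R] {k : ℕ} (x : E → R) {a : E → ZMod 2}
    (ha : ∀ i, a (C.dart i).1 = 0) {c₁ : M.closedEdges C.left ⊕ TargetEdge k → ZMod 2}
    {c₂ : M.closedEdges C.leftᶜ ⊕ TargetEdge k → ZMod 2}
    (h₁ : ∀ e, c₁ (Sum.inl e) = a e.1) (h₂ : ∀ e, c₂ (Sum.inl e) = a e.1) :
    ∏ e ∈ supp a, x e = scalarPart x (supp c₁) * scalarPart x (supp c₂) := by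
  have key : ∀ (P : Set E) (c : P ⊕ TargetEdge k → ZMod 2), (∀ e, c (Sum.inl e) = a e.1) →
      scalarPart x (supp c) = ∏ e ∈ supp a with e ∈ P, x e := by
    intro P c hc
    rw [scalarPart]
    refine Finset.prod_nbij Subtype.val ?_ Subtype.val_injective.injOn ?_ (fun _ _ => rfl)
    · intro e he
      simpa [supp, hc] using he
    · intro e he
      simp only [supp, Finset.coe_filter, Finset.mem_filter, Finset.mem_univ, true_and,
        Set.mem_ofPred_eq] at he
      exact ⟨⟨e, he.2⟩, by simp [supp, hc, he.1], rfl⟩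
  rw [key _ _ h₁, key _ _ h₂, ← Finset.prod_filter_mul_prod_filter_not (supp a)
    (fun e => e ∈ M.closedEdges C.left)]
  congr 1
  refine Finset.prod_congr (Finset.filter_congr fun e he => ?_) fun _ _ => rfl
  refine ⟨C.mem_right_of_notMem, fun h2 h1 => ?_⟩
  obtain ⟨i, rfl⟩ := C.exists_dart_of_mem h1 h2
  simp [supp, ha] at he

variable [Fintype E] {k : ℕ} (pos : Fin k → Fin C.length)

/-- The legs through which the left part of an even set is continued: those at whose end vertex
the left part has odd degree. -/
def oddLegs (a : E → ZMod 2) : Fin k → ZMod 2 := fun j =>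
  M.boundaryOne (extendChain fun e : M.closedEdges C.left => a e.1) (M.tail (C.dart (pos j)))

variable {C} {pos} {G : M.EmbeddedGraph}

theorem boundaryOne_eq_zero_of_notMem_verts {a : E → ZMod 2} (ha : ∀ e ∉ G.edges, a e = 0)
    {P : Set E} {v : M.Vertex} (hv : v ∉ G.verts) :
    M.boundaryOne (extendChain fun e : P => a e.1) v = 0 := by
  classical
  rw [boundaryOne_apply]
  refine Finset.sum_eq_zero fun d hd => ?_
  have h : a d.1 = 0 := ha _ fun h => hv (by
    rw [← (Finset.mem_filter.mp hd).2]; exact G.tail_mem d.1 h d.2)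
  by_cases hP : d.1 ∈ P
  · rw [extendChain_of_mem _ hP, h]
  · rw [extendChain_of_notMem _ hP]

theorem sum_oddLegs (hpos : pos.Injective)
    (hrange : ∀ i, M.tail (C.dart i) ∈ G.verts → i ∈ Set.range pos) (a : M.CyclesIn G.edges) :
    ∑ j, C.oddLegs pos a.1 j = 0 := by
  refine Eq.trans ?_ (M.sum_boundaryOne (extendChain fun e : M.closedEdges C.left => a.1 e.1))
  refine Finset.sum_of_injOn (fun j => M.tail (C.dart (pos j)))
    (C.simple.comp hpos).injOn (by simp) ?_ (fun _ _ => rfl)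
  intro v _ hv
  by_cases h : ∃ i, M.tail (C.dart i) = v
  · obtain ⟨i, rfl⟩ := h
    refine boundaryOne_eq_zero_of_notMem_verts a.2.2 fun hi => hv ?_
    obtain ⟨j, rfl⟩ := hrange i hi
    exact ⟨j, by simp, rfl⟩
  · exact C.boundaryOne_extendChain_of_notMem a.2.1 fun i hi => h ⟨i, hi⟩

/-- The left part of an even set becomes even after adding the arcs of the curve which pair up its
vertices of odd degree. -/
theorem extendChain_add_curveChain_mem_cycles (hpos : pos.Injective)
    (hrange : ∀ i, M.tail (C.dart i) ∈ G.verts → i ∈ Set.range pos) (a : M.CyclesIn G.edges) :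
    extendChain (fun e : M.closedEdges C.left => a.1 e.1) +
      C.curveChain (partialSum pos (C.oddLegs pos a.1)) ∈ M.Cycles := by
  have hI := sum_oddLegs hpos hrange a
  rw [← boundaryOne_eq_zero_iff, map_add]
  ext v
  rw [Pi.add_apply, Pi.zero_apply]
  by_cases h : ∃ i, M.tail (C.dart i) = v
  · obtain ⟨i, rfl⟩ := h
    rw [C.boundaryOne_curveChain_tail]
    by_cases hi : i ∈ Set.range pos
    · obtain ⟨j, rfl⟩ := hi
      rw [partialSum_add_sub_one hI hpos]
      exact CharTwo.add_self_eq_zero _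
    · rw [partialSum_sub_one_of_notMem hI hi, CharTwo.add_self_eq_zero, add_zero]
      exact boundaryOne_eq_zero_of_notMem_verts a.2.2 fun h => hi (hrange i h)
  · have h' : ∀ i, M.tail (C.dart i) ≠ v := fun i hi => h ⟨i, hi⟩
    rw [C.boundaryOne_curveChain_of_notMem _ h', C.boundaryOne_extendChain_of_notMem a.2.1 h',
      add_zero]

theorem extendChain_add_curveChain_mem_cycles_right (hCG : C.MeetsInVertices G)
    (hpos : pos.Injective)
    (hrange : ∀ i, M.tail (C.dart i) ∈ G.verts → i ∈ Set.range pos) (a : M.CyclesIn G.edges) :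
    extendChain (fun e : M.closedEdges C.leftᶜ => a.1 e.1) +
      C.curveChain (partialSum pos (C.oddLegs pos a.1)) ∈ M.Cycles := by
  have h := extendChain_add_curveChain_mem_cycles hpos hrange a
  rw [← Submodule.add_mem_iff_right _ h, add_cancel_middle,
    ← C.eq_add_extendChain fun i => a.2.2 _ (hCG i)]
  exact a.2.1

section Glue

variable {corner₁ : Fin k → Dart (M.closedEdges C.left)} {r₁ : Equiv.Perm (Fin k)}
  {corner₂ : Fin k → Dart (M.closedEdges C.leftᶜ)} {r₂ : Equiv.Perm (Fin k)}

open scoped Classical in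
/-- Two even sets with the same legs, one on each side, glue to an even set. -/
theorem add_extendChain_mem_cycles
    (hL : C.IsSide corner₁ r₁ pos) (hR : C.IsSide corner₂ r₂ pos)
    {c₁ : M.closedEdges C.left ⊕ TargetEdge k → ZMod 2}
    {c₂ : M.closedEdges C.leftᶜ ⊕ TargetEdge k → ZMod 2}
    (h₁ : c₁ ∈ ((M.restrict (M.closedEdges C.left)).attachTarget corner₁ r₁).Cycles)
    (h₂ : c₂ ∈ ((M.restrict (M.closedEdges C.leftᶜ)).attachTarget corner₂ r₂).Cycles)
    (h : ∀ j, c₁ (Sum.inr (Sum.inr j)) = c₂ (Sum.inr (Sum.inr j))) :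
    extendChain (fun e : M.closedEdges C.left => c₁ (Sum.inl e)) +
      extendChain (fun e : M.closedEdges C.leftᶜ => c₂ (Sum.inl e)) ∈ M.Cycles := by
  have hI := cycle_sum_legs _ r₁ hL.corner_injective h₁
  have h1 := (hL.mem_cycles_iff hI (cycle_inner_eq_outer _ r₁ hL.corner_injective h₁)
    fun _ => rfl).mp h₁
  have h2 := (hR.mem_cycles_iff hI (fun j =>
    (cycle_inner_eq_outer _ r₂ hR.corner_injective h₂ j).trans (h j).symm)
    fun j => (h j).symm).mp h₂
  have h3 := add_mem h1 h2
  rwa [add_cancel_middle] at h3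

open scoped Classical in
/-- The value of a quadratic form on an even set is the sum of the values of its restrictions on
the two parts, continued through the same legs. -/
theorem quadForm_eq_add (hCG : C.MeetsInVertices G) (hpos : pos.Injective)
    (hrange : ∀ i, M.tail (C.dart i) ∈ G.verts → i ∈ Set.range pos)
    (hL : C.IsSide corner₁ r₁ pos) (hR : C.IsSide corner₂ r₂ pos) {q : M.QuadForm}
    {q₁ : ((M.restrict (M.closedEdges C.left)).attachTarget corner₁ r₁).QuadForm}
    {q₂ : ((M.restrict (M.closedEdges C.leftᶜ)).attachTarget corner₂ r₂).QuadForm}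
    (hq₁ : IsRestriction q _ q₁) (hq₂ : IsRestriction q _ q₂) (a : M.CyclesIn G.edges)
    {c₁ : M.closedEdges C.left ⊕ TargetEdge k → ZMod 2}
    {c₂ : M.closedEdges C.leftᶜ ⊕ TargetEdge k → ZMod 2}
    (h₁ : c₁ ∈ ((M.restrict (M.closedEdges C.left)).attachTarget corner₁ r₁).Cycles)
    (h₂ : c₂ ∈ ((M.restrict (M.closedEdges C.leftᶜ)).attachTarget corner₂ r₂).Cycles)
    (ha₁ : ∀ e, c₁ (Sum.inl e) = a.1 e.1) (ha₂ : ∀ e, c₂ (Sum.inl e) = a.1 e.1)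
    (hI₁ : ∀ j, c₁ (Sum.inr (Sum.inr j)) = C.oddLegs pos a.1 j)
    (hI₂ : ∀ j, c₂ (Sum.inr (Sum.inr j)) = C.oddLegs pos a.1 j) :
    q.1 (M.homologyClass a.1 a.2.1) =
      q₁.1 (homologyClass _ c₁ h₁) + q₂.1 (homologyClass _ c₂ h₂) := by
  have hL' := extendChain_add_curveChain_mem_cycles hpos hrange a
  have hR' := extendChain_add_curveChain_mem_cycles_right hCG hpos hrange a
  have e₁ : (fun e => c₁ (Sum.inl e)) = fun e : M.closedEdges C.left => a.1 e.1 := funext ha₁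
  have e₂ : (fun e => c₂ (Sum.inl e)) = fun e : M.closedEdges C.leftᶜ => a.1 e.1 := funext ha₂
  rw [← e₁] at hL'
  rw [← e₂] at hR'
  rw [hL.restriction_apply hq₁ h₁ hI₁ hL', hR.restriction_apply hq₂ h₂ hI₂ hR']
  have hsum : a.1 = (extendChain (fun e : M.closedEdges C.left => c₁ (Sum.inl e)) +
      C.curveChain (partialSum pos (C.oddLegs pos a.1))) +
      (extendChain (fun e : M.closedEdges C.leftᶜ => c₂ (Sum.inl e)) +
      C.curveChain (partialSum pos (C.oddLegs pos a.1))) := by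
    rw [add_cancel_middle, e₁, e₂]
    exact C.eq_add_extendChain fun i => a.2.2 _ (hCG i)
  rw [M.homologyClass_congr a.2.1 hsum, M.homologyClass_add hL' hR', q.2,
    C.intersectionForm_eq_zero, add_zero]
  · intro e he
    rw [Pi.add_apply, extendChain_of_notMem _ he, zero_add, C.curveChain_of_notMem]
    rintro i rfl
    exact he (C.mem_left i)
  · intro e he
    rw [Pi.add_apply, extendChain_of_notMem _ he, zero_add, C.curveChain_of_notMem]
    rintro i rfl
    exact he (C.mem_right i)

open scoped Classical in
theorem oddLegs_eq (hpos : pos.Injective) (hL : C.IsSide corner₁ r₁ pos)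
    {c : M.closedEdges C.left ⊕ TargetEdge k → ZMod 2}
    (hc : c ∈ ((M.restrict (M.closedEdges C.left)).attachTarget corner₁ r₁).Cycles)
    {a : E → ZMod 2} (ha : ∀ e, a e.1 = c (Sum.inl e)) (j : Fin k) :
    C.oddLegs pos a j = c (Sum.inr (Sum.inr j)) := by
  have hI := cycle_sum_legs _ r₁ hL.corner_injective hc
  have h := (hL.mem_cycles_iff hI (cycle_inner_eq_outer _ r₁ hL.corner_injective hc)
    fun _ => rfl).mp hc
  rw [← boundaryOne_eq_zero_iff, map_add] at h
  have h' := congrFun h (M.tail (C.dart (pos j)))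
  rw [Pi.add_apply, C.boundaryOne_curveChain_tail, partialSum_add_sub_one hI hpos, Pi.zero_apply,
    CharTwo.add_eq_zero] at h'
  simp only [oddLegs, ha]
  exact h'

theorem eq_zero_of_notMem_withTarget {P : Set E} {a : E → ZMod 2} (ha : ∀ e ∉ G.edges, a e = 0)
    (I : TargetEdge k → ZMod 2) :
    ∀ e ∉ G.withTarget P k, Sum.elim (fun e : P => a e.1) I e = 0 := by
  intro e he
  obtain e | t := e
  · refine ha _ fun h => he ((G.mem_withTarget_iff _).mpr ?_)
    rintro e' h'
    rwa [← Sum.inl_injective h']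
  · exact absurd ((G.mem_withTarget_iff _).mpr fun e' h => by simp at h) he

theorem apply_inl_eq_zero {P : Set E} {c : P ⊕ TargetEdge k → ZMod 2}
    (hc : ∀ e ∉ G.withTarget P k, c e = 0) (e : P) (he : e.1 ∉ G.edges) : c (Sum.inl e) = 0 :=
  hc _ fun h => he ((G.mem_withTarget_iff _).mp h e rfl)

open scoped Classical in
/-- The gluing formula, for targets that are drawn correctly on both sides of the curve: cutting
along the curve is a bijection from the even sets of the graph to the pairs of even sets of the
two parts that contain the same legs. -/
theorem signedEvenSum_eq_scalarProduct (hCG : C.MeetsInVertices G) (hpos : pos.Injective)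
    (hrange : ∀ i, M.tail (C.dart i) ∈ G.verts → i ∈ Set.range pos)
    (hL : C.IsSide corner₁ r₁ pos) (hR : C.IsSide corner₂ r₂ pos) {q : M.QuadForm}
    {q₁ : ((M.restrict (M.closedEdges C.left)).attachTarget corner₁ r₁).QuadForm}
    {q₂ : ((M.restrict (M.closedEdges C.leftᶜ)).attachTarget corner₂ r₂).QuadForm}
    (hq₁ : IsRestriction q _ q₁) (hq₂ : IsRestriction q _ q₂)
    {R : Type*} [CommRing R] (x : E → R) :
    M.signedEvenSum G.edges q (fun A => ∏ e ∈ A, x e) =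
      scalarProduct
        (signedEvenSum _ (G.withTarget (M.closedEdges C.left) k) q₁
          (gluingMonomial x leftTargetVar (leftOrder k)))
        (signedEvenSum _ (G.withTarget (M.closedEdges C.leftᶜ) k) q₂
          (gluingMonomial x rightTargetVar (rightOrder k))) := by
  rw [signedEvenSum_eq, signedEvenSum_left, signedEvenSum_right, scalarProduct_sum]
  have hI := fun a => sum_oddLegs hpos hrange a
  have part₁ : ∀ a : M.CyclesIn G.edges,
      Sum.elim (fun e => a.1 e.1) (Sum.elim (C.oddLegs pos a.1) (C.oddLegs pos a.1)) ∈
        ((M.restrict (M.closedEdges C.left)).attachTarget corner₁ r₁).Cycles := fun a =>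
    (hL.mem_cycles_iff (hI a) (fun _ => rfl) (fun _ => rfl)).mpr
      (extendChain_add_curveChain_mem_cycles hpos hrange a)
  have part₂ : ∀ a : M.CyclesIn G.edges,
      Sum.elim (fun e => a.1 e.1) (Sum.elim (C.oddLegs pos a.1) (C.oddLegs pos a.1)) ∈
        ((M.restrict (M.closedEdges C.leftᶜ)).attachTarget corner₂ r₂).Cycles := fun a =>
    (hR.mem_cycles_iff (hI a) (fun _ => rfl) (fun _ => rfl)).mpr
      (extendChain_add_curveChain_mem_cycles_right hCG hpos hrange a)
  have hlegs : ∀ (c₁ : CyclesIn ((M.restrict (M.closedEdges C.left)).attachTarget corner₁ r₁)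
        (G.withTarget (M.closedEdges C.left) k))
      (c₂ : CyclesIn ((M.restrict (M.closedEdges C.leftᶜ)).attachTarget corner₂ r₂)
        (G.withTarget (M.closedEdges C.leftᶜ) k)),
      indexSet leftIndex (supp c₁.1) = indexSet rightIndex (supp c₂.1) ↔
        ∀ j, c₁.1 (Sum.inr (Sum.inr j)) = c₂.1 (Sum.inr (Sum.inr j)) := fun c₁ c₂ =>
    indexSet_eq_iff (cycle_inner_eq_outer _ r₁ hL.corner_injective c₁.2.1)
      (cycle_inner_eq_outer _ r₂ hR.corner_injective c₂.2.1)
  simp only [hlegs]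
  refine Finset.sum_bij'
    (fun a _ => (⟨_, part₁ a, eq_zero_of_notMem_withTarget a.2.2 _⟩,
      ⟨_, part₂ a, eq_zero_of_notMem_withTarget a.2.2 _⟩))
    (fun p hp => ⟨extendChain (fun e : M.closedEdges C.left => p.1.1 (Sum.inl e)) +
      extendChain (fun e : M.closedEdges C.leftᶜ => p.2.1 (Sum.inl e)),
      add_extendChain_mem_cycles hL hR p.1.2.1 p.2.2.1 (Finset.mem_filter.mp hp).2, ?_⟩)
    ?_ (fun _ _ => Finset.mem_univ _) ?_ ?_ ?_
  · intro e he
    by_cases h : e ∈ M.closedEdges C.left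
    · exact (add_extendChain_left hCG (apply_inl_eq_zero p.2.2.2) ⟨e, h⟩).trans
        (apply_inl_eq_zero p.1.2.2 _ he)
    · exact (add_extendChain_right hCG (apply_inl_eq_zero p.1.2.2)
        ⟨e, C.mem_right_of_notMem h⟩).trans (apply_inl_eq_zero p.2.2.2 _ he)
  · intro a _
    exact Finset.mem_filter.mpr ⟨Finset.mem_univ _, fun _ => rfl⟩
  · intro a _
    exact Subtype.ext (C.eq_add_extendChain fun i => a.2.2 _ (hCG i)).symm
  · rintro ⟨c₁, c₂⟩ hp
    have hl := (Finset.mem_filter.mp hp).2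
    have h₁ := add_extendChain_left hCG (b₁ := fun e => c₁.1 (Sum.inl e))
      (apply_inl_eq_zero c₂.2.2)
    have h₂ := add_extendChain_right hCG (b₂ := fun e => c₂.1 (Sum.inl e))
      (apply_inl_eq_zero c₁.2.2)
    have ho := oddLegs_eq hpos hL c₁.2.1 h₁
    refine Prod.ext (Subtype.ext (funext fun e => ?_)) (Subtype.ext (funext fun e => ?_))
    · obtain e | j | j := e
      · exact h₁ e
      · exact (ho j).trans (cycle_inner_eq_outer _ r₁ hL.corner_injective c₁.2.1 j).symm
      · exact ho j
    · obtain e | j | j := e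
      · exact h₂ e
      · exact ((ho j).trans (hl j)).trans
          (cycle_inner_eq_outer _ r₂ hR.corner_injective c₂.2.1 j).symm
      · exact (ho j).trans (hl j)
  · intro a _
    rw [quadForm_eq_add hCG hpos hrange hL hR hq₁ hq₂ a (part₁ a) (part₂ a) (fun _ => rfl)
      (fun _ => rfl) (fun _ => rfl) (fun _ => rfl), neg_one_pow_val_add,
      C.prod_supp_eq x (fun i => a.2.2 _ (hCG i))
        (c₁ := Sum.elim (fun e => a.1 e.1) (Sum.elim (C.oddLegs pos a.1) (C.oddLegs pos a.1)))
        (c₂ := Sum.elim (fun e => a.1 e.1) (Sum.elim (C.oddLegs pos a.1) (C.oddLegs pos a.1)))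
        (fun _ => rfl) (fun _ => rfl)]
    exact mul_mul_mul_comm _ _ _ _

end Glue

end SeparatingCurve

end CellSurface

end IsingGluing

end

open IsingGluing CellSurface in
open scoped Classical in
theorem theorem3p3 {E : Type*} [Fintype E] (M : CellSurface E) (hM : M.IsDoubleTorus)
    (C : M.SeparatingCurve) (G : M.EmbeddedGraph) (hCG : C.MeetsInVertices G)
    {R : Type*} [CommRing R] (x : E → R) (q : M.QuadForm) :
    (∃! q₁ : (C.leftTorus G).QuadForm, IsRestriction q (C.leftTorus G) q₁) ∧
    (∃! q₂ : (C.rightTorus G).QuadForm, IsRestriction q (C.rightTorus G) q₂) ∧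
    ∀ (q₁ : (C.leftTorus G).QuadForm) (q₂ : (C.rightTorus G).QuadForm),
      IsRestriction q (C.leftTorus G) q₁ → IsRestriction q (C.rightTorus G) q₂ →
      M.signedEvenSum G.edges q (fun A => ∏ e ∈ A, x e) =
        scalarProduct
          ((C.leftTorus G).signedEvenSum
            (G.withTarget (M.closedEdges C.left) (C.numGluing G)) q₁
            (gluingMonomial x leftTargetVar (leftOrder (C.numGluing G))))
          ((C.rightTorus G).signedEvenSum
            (G.withTarget (M.closedEdges C.leftᶜ) (C.numGluing G)) q₂
            (gluingMonomial x rightTargetVar (rightOrder (C.numGluing G)))) := by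
  have hpos : StrictMono (C.gluingPos G) := (Finset.orderEmbOfFin _ rfl).strictMono
  have hrange : ∀ i, M.tail (C.dart i) ∈ G.verts → i ∈ Set.range (C.gluingPos G) := by
    intro i hi
    have h : i ∈ (C.positions G : Set (Fin C.length)) := by
      simpa [SeparatingCurve.positions] using hi
    rwa [← Finset.range_orderEmbOfFin _ rfl] at h
  have hL := C.isSide_left hpos
  have hR := C.isSide_right hpos
  exact ⟨hL.existsUnique_isRestriction q, hR.existsUnique_isRestriction q,
    fun q₁ q₂ hq₁ hq₂ =>
      SeparatingCurve.signedEvenSum_eq_scalarProduct hCG hpos.injective hrange hL hR hq₁ hq₂ x⟩
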